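/- Let $K$ be a number field and let $v$ be a non-archimedean place of $K$ that does not divide $2$, with absolute value $|\cdot| = |\cdot|_v$ (in any normalization). Let $\mathbb{C}_v$ be the completion of an algebraic closure of $K_v$, and let $\mathbf{A}^{1,an}_v$ be the Berkovich affine line over $\mathbb{C}_v$, i.e. the space of multiplicative seminorms $P \mapsto |P|_x$ on $\mathbb{C}_v[X]$ extending $|\cdot|$. For $c \in K$ let $f_c(z) = z^2 + c$, let $$\lambda_c(x) = \lim_{n\to\infty} \frac{1}{2^n} \log \max\{ |f_c^n|_x, 1 \}, \qquad x \in \mathbf{A}^{1,an}_v,$$ be its escape rate (so $\lambda_c(z) = \lim_n 2^{-n}\log\max\{|f_c^n(z)|,1\}$ at the points $z\in\mathbb{C}_v$), and let $\mu_c$ be its canonical measure, the probability measure on $\mathbf{A}^{1,an}_v$ that is the Laplacian of $\lambda_c$. For $c_1, c_2 \in K$ put $$E_v = \int_{\mathbf{A}^{1,an}_v} \lambda_{c_1} \, d\mu_{c_2} .$$ Then, for all $c_1, c_2 \in K$, the function $\lambda_{c_1}$ is $\mu_{c_2}$-integrable and $$\frac14 \log^+ |c_1 - c_2| \;\le\;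 E_v \;\le\; \frac12 \log^+ \max\{|c_1|, |c_2|\},$$ where $\log^+ t = \max\{\log t, 0\}$ and $\log^+ 0 = 0$. Furthermore, if $r := |c_1| = |c_2| > 1$ and $|c_1 - c_2| > r^{-1/2}$, then $$E_v \;\ge\; \frac{1}{16} \log r .$$ -/

import Mathlib

open scoped Polynomial Real
open Polynomial MeasureTheory Topology Filter

noncomputable section

/-! ### Non-archimedean places and the field `ℂ_v` -/

/-- A non-archimedean place of a field `K`, given by a nontrivial non-archimedean absolute value
`|·|_v` in its equivalence class. Every normalization of `|·|_v` is allowed. -/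
structure NonarchPlace (K : Type*) [Field K] where
  /-- the absolute value `|·|_v` -/
  abv : AbsoluteValue K ℝ
  isNonarchimedean : IsNonarchimedean abv
  isNontrivial : abv.IsNontrivial

namespace NonarchPlace

variable {K : Type*} [Field K] (v : NonarchPlace K)

instance : IsUltrametricDist (WithAbs v.abv) :=
  IsUltrametricDist.isUltrametricDist_of_forall_norm_add_le_max_norm fun x y =>
    v.isNonarchimedean x.ofAbs y.ofAbs

/-- `K_v`, the completion of `K` at `v`. -/
abbrev LocalField : Type _ := v.abv.Completion

instance : IsUltrametricDist v.LocalField :=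
  IsUltrametricDist.of_normedAlgebra (WithAbs v.abv)

instance : NontriviallyNormedField v.LocalField where
  non_trivial := by
    obtain ⟨x, hx⟩ := v.isNontrivial.exists_abv_gt_one
    refine ⟨((WithAbs.toAbs v.abv x : WithAbs v.abv) : v.LocalField), ?_⟩
    rw [UniformSpace.Completion.norm_coe]
    exact hx

/-- An algebraic closure of `K_v`. -/
abbrev LocalAlgCl : Type _ := AlgebraicClosure v.LocalField

/-- The absolute value on the algebraic closure is the unique extension of `|·|_v`. -/
instance : NormedField v.LocalAlgCl := spectralNorm.normedField v.LocalField v.LocalAlgCl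

instance : NormedAlgebra v.LocalField v.LocalAlgCl := spectralNorm.normedAlgebra _ _

instance : IsUltrametricDist v.LocalAlgCl :=
  IsUltrametricDist.isUltrametricDist_of_forall_norm_add_le_max_norm
    (isNonarchimedean_spectralNorm (K := v.LocalField) (L := v.LocalAlgCl))

/-- `ℂ_v`, the completion of an algebraic closure of `K_v`. -/
abbrev Cv : Type _ := UniformSpace.Completion v.LocalAlgCl

instance : IsUltrametricDist v.Cv := IsUltrametricDist.of_normedAlgebra v.LocalAlgCl

/-- The embedding of `K` in `ℂ_v`. -/
def toCv : K →+* v.Cv :=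
  (UniformSpace.Completion.coeRingHom (α := v.LocalAlgCl)).comp
    ((algebraMap v.LocalField v.LocalAlgCl).comp
      ((UniformSpace.Completion.coeRingHom (α := WithAbs v.abv)).comp
        (WithAbs.equiv v.abv).symm.toRingHom))

theorem norm_toCv (x : K) : ‖v.toCv x‖ = v.abv x := by
  have h1 : ‖v.toCv x‖ = ‖algebraMap v.LocalField v.LocalAlgCl
      ((WithAbs.toAbs v.abv x : WithAbs v.abv) : v.LocalField)‖ :=
    UniformSpace.Completion.norm_coe _
  have h2 : ‖algebraMap v.LocalField v.LocalAlgCl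
      ((WithAbs.toAbs v.abv x : WithAbs v.abv) : v.LocalField)‖ =
      ‖((WithAbs.toAbs v.abv x : WithAbs v.abv) : v.LocalField)‖ := norm_algebraMap' _ _
  rw [h1, h2, UniformSpace.Completion.norm_coe]
  rfl

end NonarchPlace

/-! ### The Berkovich affine line -/

/-- The Berkovich affine line over a normed field `L`: the multiplicative seminorms on `L[X]` that
extend the absolute value of `L`. -/
def BerkovichLine (L : Type*) [NormedField L] : Type _ :=
  {x : MulRingSeminorm L[X] // ∀ a : L, x (C a) = ‖a‖}

namespace BerkovichLine

variable {L : Type*} [NormedField L]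

/-- `x.eval P` is the value `|P|_x` at `P` of the seminorm `x`. -/
def eval (x : BerkovichLine L) (P : L[X]) : ℝ := x.1 P

/-- The Berkovich topology: the coarsest one making every `x ↦ |P|_x` continuous. -/
instance : TopologicalSpace (BerkovichLine L) :=
  TopologicalSpace.induced (fun x P => x.eval P) inferInstance

instance : MeasurableSpace (BerkovichLine L) := borel _

instance : BorelSpace (BerkovichLine L) := ⟨rfl⟩

/-- The type I point of `z ∈ L`: the seminorm `P ↦ |P(z)|`. -/
def ofPoint (z : L) : BerkovichLine L :=
  ⟨{ toFun := fun P => ‖P.eval z‖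
     map_zero' := by simp
     add_le' := fun P Q => by simpa using norm_add_le (P.eval z) (Q.eval z)
     neg' := fun P => by simp
     map_one' := by simp
     map_mul' := fun P Q => by simp }, fun a => show ‖(C a).eval z‖ = ‖a‖ by simp⟩

variable [IsUltrametricDist L]

/-- The point `ζ_{a,r}` of the disk with centre `a` and radius `r > 0`: the seminorm
`∑ bᵢ (X - a)ⁱ ↦ maxᵢ |bᵢ| rⁱ`. -/
def diskPoint (a : L) (r : {r : ℝ // 0 < r}) : BerkovichLine L :=
  have hna : IsNonarchimedean (NormedField.toAbsoluteValue L) := IsUltrametricDist.norm_add_le_max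
  ⟨{ toFun := fun P => (taylor a P).gaussNorm (NormedField.toAbsoluteValue L) r
     map_zero' := by simp
     add_le' := fun P Q => by
      have h0 := fun R : L[X] => R.gaussNorm_nonneg (NormedField.toAbsoluteValue L) r.2.le
      have := isNonarchimedean_gaussNorm _ hna r.2.le (taylor a P) (taylor a Q)
      rw [map_add]
      exact this.trans (max_le_add_of_nonneg (h0 _) (h0 _))
     neg' := fun P => by
      have h : taylor a (-P) = C (-1 : L) * taylor a P := by simp
      rw [h, gaussNorm_mul hna r.2, gaussNorm_C, AbsoluteValue.map_neg, map_one, one_mul]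
     map_one' := by
      rw [taylor_one, gaussNorm_C, map_one]
     map_mul' := fun P Q => by
      rw [taylor_mul, gaussNorm_mul hna r.2] },
   fun b => show (taylor a (C b)).gaussNorm (NormedField.toAbsoluteValue L) (r : ℝ) = ‖b‖ by
      rw [taylor_C, gaussNorm_C]; rfl⟩

/-- The function `x ↦ log max(|X - a|_x, r)` on the Berkovich line. Its Laplacian on the affine
line is the Dirac mass at `ζ_{a,r}`. -/
def diskPotential (a : L) (r : {r : ℝ // 0 < r}) (x : BerkovichLine L) : ℝ :=
  Real.log (max (x.eval (X - C a)) r)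

/-- `Δ u = μ` on the Berkovich affine line, in the sense of distributions: `∫ φ dμ = ∫ u d(Δ φ)`
for the compactly supported test functions
`φ = log max(|X - a|, r) - log max(|X - b|, s)`, for which `Δ φ = δ_{ζ_{a,r}} - δ_{ζ_{b,s}}`.
The linear combinations of these `φ` are all the compactly supported functions that are
piecewise affine on a finite subtree (and locally constant off it), the usual test functions of
potential theory on the line. -/
def HasLaplacian (u : BerkovichLine L → ℝ) (μ : Measure (BerkovichLine L)) : Prop :=
  ∀ (a b : L) (r s : {r : ℝ // 0 < r}),
    ∫ x, (diskPotential a r x - diskPotential b s x) ∂μ = u (diskPoint a r) - u (diskPoint b s)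

end BerkovichLine

/-! ### Dynamics of `f_c(z) = z² + c` -/

section Dynamics

open BerkovichLine

variable {L : Type*} [NormedField L]

/-- The `n`-th iterate of `f_c = X² + c`, as a polynomial. -/
def iterPoly (c : L) (n : ℕ) : L[X] := (fun P : L[X] => P ^ 2 + C c)^[n] X

theorem eval_iterPoly (c z : L) (n : ℕ) :
    (iterPoly c n).eval z = (fun w : L => w ^ 2 + c)^[n] z := by
  induction n with
  | zero => simp [iterPoly]
  | succ n ih =>
    rw [Function.iterate_succ_apply', ← ih, iterPoly, Function.iterate_succ_apply', ← iterPoly]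
    simp

/-- The escape rate `λ_c(x) = lim 2⁻ⁿ log max(|f_c^n|_x, 1)` on the Berkovich line. -/
def escapeRate (c : L) (x : BerkovichLine L) : ℝ :=
  limUnder atTop fun n : ℕ => (1 / 2 ^ n : ℝ) * Real.log (max (x.eval (iterPoly c n)) 1)

/-- On type I points `escapeRate` is the classical escape rate
`λ_c(z) = lim 2⁻ⁿ log max(|f_c^n(z)|, 1)`. -/
theorem escapeRate_ofPoint (c z : L) :
    escapeRate c (ofPoint z) = limUnder atTop fun n : ℕ =>
      (1 / 2 ^ n : ℝ) * Real.log (max ‖(fun w : L => w ^ 2 + c)^[n] z‖ 1) := by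
  simp_rw [← eval_iterPoly]
  rfl

variable [IsUltrametricDist L]

open Classical in
/-- The canonical (equilibrium) measure `μ_c` of `f_c`: the probability measure on the Berkovich
affine line that is the Laplacian of `λ_c`. -/
def canonicalMeasure (c : L) : Measure (BerkovichLine L) :=
  if h : ∃ μ : Measure (BerkovichLine L), IsProbabilityMeasure μ ∧ HasLaplacian (escapeRate c) μ
  then h.choose else 0

end Dynamics

namespace NonarchPlace

variable {K : Type*} [Field K] (v : NonarchPlace K)

/-- The local energy `E_v = ∫ λ_{c₁,v} dμ_{c₂,v}` over the Berkovich affine line over `ℂ_v`. -/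
def localEnergy (c₁ c₂ : K) : ℝ :=
  ∫ x, escapeRate (v.toCv c₁) x ∂(canonicalMeasure (v.toCv c₂))

end NonarchPlace

end

/-!
Away from residue characteristic `2`, the preimage under `f_c` of a disk consists of two disks
`D(± w, r')`, and the potential `log max(|X - a|, r)` of the disk pulls back to the sum of the
potentials of these two. Hence `2⁻ⁿ log⁺ |f_c^n|` is the mean of the potentials of the `2ⁿ`
preimages of the unit disk under `f_c^n`. Potentials are symmetric in the two disks, so the mean
over these preimages of a single potential converges to a value of `λ_c`: a limit of the uniform
measures on the preimages is a positive functional, and Riesz–Markov turns it into `μ_c`.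

Conversely `μ_c` integrates the potential of a disk to the value of `λ_c` at the point of the disk.
Therefore the energy is the limit of the means of `λ_c` over the preimages of the unit disk under
`f_{c'}^n`. These preimages lie within the escape radius of `c'`, which yields the upper bound. For
the lower bounds it suffices to bound the mean of `λ_c` over the preimages under `f_{c'}^k` of an
arbitrary point within that radius, for some `k ≤ 3`: an orbit `p₀ ↦ p₁ ↦ p₂ ↦ p₃` of `f_{c'}` is
compared with the `f_c`-orbit of `p₀`. When `|c - c'|` is small against the escape radius the latter
need escape for only one of the two choices `± p₁`, and it does, because the deviations at `p₁` and
`-p₁` cannot both be small.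
-/

noncomputable section

section RealInequalities

theorem le_of_forall_pow_le_add_one_mul_pow {a b : ℝ} (hb : 0 ≤ b)
    (h : ∀ n : ℕ, a ^ n ≤ (n + 1) * b ^ n) : a ≤ b := by
  by_contra! hab
  rcases hb.eq_or_lt with rfl | hb
  · linarith [h 1]
  · obtain ⟨n, hn⟩ := Real.exists_natCast_add_one_lt_pow_of_one_lt ((one_lt_div hb).2 hab)
    rw [div_pow, lt_div_iff₀ (by positivity)] at hn
    exact hn.not_ge (h n)

end RealInequalities

section Nonarchimedean

theorem isNonarchimedean_of_natCast_le_one {R : Type*} [CommRing R] (f : MulRingSeminorm R)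
    (h : ∀ n : ℕ, f n ≤ 1) : IsNonarchimedean f := by
  intro a b
  set M := max (f a) (f b)
  have hM : 0 ≤ M := le_max_of_le_left (apply_nonneg f a)
  refine le_of_forall_pow_le_add_one_mul_pow hM fun n => ?_
  have term_le (i : ℕ) (hi : i ∈ Finset.range (n + 1)) :
      f (a ^ i * b ^ (n - i) * n.choose i) ≤ M ^ n := by
    rw [map_mul, map_mul, map_pow, map_pow]
    calc f a ^ i * f b ^ (n - i) * f (n.choose i)
        ≤ M ^ i * M ^ (n - i) * 1 := by
          gcongr
          · exact le_max_left _ _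
          · exact le_max_right _ _
          · exact h _
      _ = M ^ n := by rw [mul_one, pow_mul_pow_sub M (Finset.mem_range_succ_iff.1 hi)]
  calc f (a + b) ^ n = f (∑ i ∈ Finset.range (n + 1), a ^ i * b ^ (n - i) * n.choose i) := by
        rw [← map_pow, add_pow]
    _ ≤ ∑ i ∈ Finset.range (n + 1), f (a ^ i * b ^ (n - i) * n.choose i) :=
        Finset.le_sum_of_subadditive f (map_zero f).le (map_add_le_add f) _ _
    _ ≤ ∑ _ ∈ Finset.range (n + 1), M ^ n := Finset.sum_le_sum term_le
    _ = (n + 1) * M ^ n := by simp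

variable {E : Type*} [SeminormedAddCommGroup E] [IsUltrametricDist E] {a b : E} {t : ℝ}

theorem norm_add_eq_left_of_lt (h : ‖b‖ < ‖a‖) : ‖a + b‖ = ‖a‖ := by
  rw [IsUltrametricDist.norm_add_eq_max_of_norm_ne_norm h.ne', max_eq_left h.le]

theorem norm_sub_le_max_norm (a b : E) : ‖a - b‖ ≤ max ‖a‖ ‖b‖ := by
  simpa only [sub_eq_add_neg, norm_neg] using IsUltrametricDist.norm_add_le_max a (-b)

theorem norm_sub_le_of_norm_le (ha : ‖a‖ ≤ t) (hb : ‖b‖ ≤ t) : ‖a - b‖ ≤ t :=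
  (norm_sub_le_max_norm a b).trans (max_le ha hb)

theorem le_norm_add_of_lt_of_le (ha : ‖a‖ < t) (hb : t ≤ ‖b‖) : t ≤ ‖a + b‖ := by
  rwa [add_comm, norm_add_eq_left_of_lt (ha.trans_le hb)]

theorem le_norm_or_le_norm_of_le_norm_sub (h : t ≤ ‖a - b‖) : t ≤ ‖a‖ ∨ t ≤ ‖b‖ :=
  le_max_iff.1 (h.trans (norm_sub_le_max_norm a b))

end Nonarchimedean

section SquareRoots

/-- Every element is a square. Over such a field each point has preimages under `z ↦ z² + c`,
which is all that the dynamics needs of an algebraically closed field. -/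
class IsQuadraticallyClosed (L : Type*) [Field L] : Prop where
  isSquare (u : L) : IsSquare u

variable {L : Type*} [NormedField L] [IsUltrametricDist L] [CompleteSpace L]

theorem isSquare_one_add_of_norm_lt_one (h2 : ‖(2 : L)‖ = 1) {ε : L} (hε : ‖ε‖ < 1) :
    IsSquare (1 + ε) := by
  have h20 : (2 : L) ≠ 0 := norm_ne_zero_iff.1 (h2 ▸ one_ne_zero)
  -- `(1 + x) ^ 2 = 1 + ε` if and only if `x` is a fixed point of `g`.
  let g : L → L := fun x => (ε - x ^ 2) / 2
  let s := Metric.closedBall (0 : L) ‖ε‖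
  have hgs : Set.MapsTo g s s := fun x hx => by
    rw [mem_closedBall_zero_iff] at hx ⊢
    rw [norm_div, h2, div_one]
    refine norm_sub_le_of_norm_le le_rfl ?_
    rw [norm_pow]
    exact (pow_le_of_le_one (norm_nonneg x) (hx.trans hε.le) two_ne_zero).trans hx
  have hg : ContractingWith ‖ε‖₊ (hgs.restrict g s s) := by
    refine ⟨hε, LipschitzWith.of_dist_le_mul fun x y => ?_⟩
    have hsub : g x - g y = (y + x) * (y - x) / 2 := by simp only [g]; ring
    have hadd : ‖(y + x : L)‖ ≤ ‖ε‖ := (IsUltrametricDist.norm_add_le_max _ _).trans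
      (max_le (mem_closedBall_zero_iff.1 y.2) (mem_closedBall_zero_iff.1 x.2))
    rw [Subtype.dist_eq, Subtype.dist_eq, dist_comm (x : L), dist_eq_norm, dist_eq_norm,
      Set.MapsTo.val_restrict_apply, Set.MapsTo.val_restrict_apply, hsub, norm_div, h2, div_one,
      norm_mul]
    gcongr
    exact hadd
  obtain ⟨x, -, hx, -⟩ := hg.exists_fixedPoint' Metric.isClosed_closedBall.isComplete hgs
    (Metric.mem_closedBall_self (norm_nonneg ε)) (edist_ne_top _ _)
  have hx : (ε - x ^ 2) / 2 = x := hx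
  rw [div_eq_iff h20] at hx
  exact ⟨1 + x, by linear_combination hx⟩

theorem isQuadraticallyClosed_of_denseRange {F : Type*} [Field F] [IsAlgClosed F] {i : F →+* L}
    (hi : DenseRange i) (h2 : ‖(2 : L)‖ = 1) : IsQuadraticallyClosed L := by
  refine ⟨fun u => ?_⟩
  rcases eq_or_ne u 0 with rfl | hu
  · exact IsSquare.zero
  obtain ⟨a, ha⟩ := hi.exists_dist_lt u (norm_pos_iff.2 hu)
  rw [dist_eq_norm] at ha
  have hnorm : ‖i a‖ = ‖u‖ := by
    rw [← norm_add_eq_left_of_lt (a := u) (b := i a - u) (by rwa [norm_sub_rev]), add_sub_cancel]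
  have hia : i a ≠ 0 := norm_ne_zero_iff.1 (hnorm ▸ norm_ne_zero_iff.2 hu)
  have hε : ‖(u - i a) / i a‖ < 1 := by
    rwa [norm_div, hnorm, div_lt_one (norm_pos_iff.2 hu)]
  have hu_eq : u = i a * (1 + (u - i a) / i a) := by field_simp; ring
  rw [hu_eq]
  exact (IsSquare.map i (IsAlgClosed.exists_eq_mul_self a)).mul
    (isSquare_one_add_of_norm_lt_one h2 hε)

end SquareRoots

namespace BerkovichLine

variable {L : Type*} [NormedField L] (x : BerkovichLine L)

section Seminorm

theorem eval_zero : x.eval 0 = 0 := map_zero x.1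

theorem eval_one : x.eval 1 = 1 := map_one x.1

theorem eval_C (a : L) : x.eval (C a) = ‖a‖ := x.2 a

theorem eval_nonneg (P : L[X]) : 0 ≤ x.eval P := apply_nonneg x.1 P

theorem eval_neg (P : L[X]) : x.eval (-P) = x.eval P := map_neg_eq_map x.1 P

theorem eval_add_le (P Q : L[X]) : x.eval (P + Q) ≤ x.eval P + x.eval Q := map_add_le_add x.1 P Q

theorem eval_mul (P Q : L[X]) : x.eval (P * Q) = x.eval P * x.eval Q := map_mul x.1 P Q

theorem eval_pow (P : L[X]) (n : ℕ) : x.eval (P ^ n) = x.eval P ^ n := map_pow x.1 P n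

variable {x} in
theorem ext_eval {y : BerkovichLine L} (h : ∀ P, x.eval P = y.eval P) : x = y :=
  Subtype.ext (MulRingSeminorm.ext h)

theorem eval_le_sum_norm_coeff_mul_pow (P : L[X]) :
    x.eval P ≤ ∑ i ∈ Finset.range (P.natDegree + 1), ‖P.coeff i‖ * x.eval X ^ i := by
  calc x.eval P = x.eval (∑ i ∈ Finset.range (P.natDegree + 1), C (P.coeff i) * X ^ i) := by
        rw [← P.as_sum_range_C_mul_X_pow]
    _ ≤ ∑ i ∈ Finset.range (P.natDegree + 1), x.eval (C (P.coeff i) * X ^ i) :=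
        Finset.le_sum_of_subadditive _ x.eval_zero.le x.eval_add_le _ _
    _ = _ := by simp only [eval_mul, eval_C, eval_pow]

variable [IsUltrametricDist L]

theorem isNonarchimedean_eval : IsNonarchimedean x.eval :=
  isNonarchimedean_of_natCast_le_one x.1 fun n => by
    rw [← C_eq_natCast, x.2]
    exact IsUltrametricDist.norm_natCast_le_one L n

theorem eval_add_le_max (P Q : L[X]) : x.eval (P + Q) ≤ max (x.eval P) (x.eval Q) :=
  x.isNonarchimedean_eval P Q

theorem eval_add_eq_left_of_lt {P Q : L[X]} (h : x.eval Q < x.eval P) :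
    x.eval (P + Q) = x.eval P :=
  IsNonarchimedean.add_eq_left_of_lt (f := x.1) x.isNonarchimedean_eval h

theorem eval_X_sub_C_of_norm_lt {a : L} (h : ‖a‖ < x.eval X) : x.eval (X - C a) = x.eval X := by
  rw [sub_eq_add_neg, x.eval_add_eq_left_of_lt]
  rwa [eval_neg, eval_C]

theorem posLog_eval_add_le (P Q : L[X]) :
    Real.posLog (x.eval (P + Q)) ≤ Real.posLog (x.eval P) + Real.posLog (x.eval Q) := by
  refine (Real.posLog_le_posLog (x.eval_nonneg _) (x.eval_add_le_max P Q)).trans ?_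
  rcases max_choice (x.eval P) (x.eval Q) with h | h <;> rw [h]
  · exact le_add_of_nonneg_right Real.posLog_nonneg
  · exact le_add_of_nonneg_left Real.posLog_nonneg

theorem abs_posLog_eval_sub_posLog_eval_add_le (P Q : L[X]) :
    |Real.posLog (x.eval P) - Real.posLog (x.eval (P + Q))| ≤ Real.posLog (x.eval Q) := by
  have h₁ := x.posLog_eval_add_le P Q
  have h₂ := x.posLog_eval_add_le (P + Q) (-Q)
  rw [add_neg_cancel_right, eval_neg] at h₂
  exact abs_le.2 ⟨by linarith, by linarith⟩

end Seminorm

section DiskPoint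

variable [IsUltrametricDist L]

theorem norm_coeff_taylor_mul_pow_le_eval_diskPoint (a : L) (r : {r : ℝ // 0 < r}) (P : L[X])
    (i : ℕ) : ‖(taylor a P).coeff i‖ * (r : ℝ) ^ i ≤ (diskPoint a r).eval P :=
  le_gaussNorm (NormedField.toAbsoluteValue L) (taylor a P) r.2.le i

theorem exists_eval_diskPoint_eq (a : L) (r : {r : ℝ // 0 < r}) (P : L[X]) :
    ∃ i, (diskPoint a r).eval P = ‖(taylor a P).coeff i‖ * (r : ℝ) ^ i :=
  exists_eq_gaussNorm (NormedField.toAbsoluteValue L) (r : ℝ) (taylor a P)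

theorem norm_eval_le_eval_diskPoint (a : L) (r : {r : ℝ // 0 < r}) (P : L[X]) :
    ‖P.eval a‖ ≤ (diskPoint a r).eval P := by
  simpa only [taylor_coeff_zero, pow_zero, mul_one] using
    norm_coeff_taylor_mul_pow_le_eval_diskPoint a r P 0

theorem eval_diskPoint_X_sub_C (a b : L) (r : {r : ℝ // 0 < r}) :
    (diskPoint a r).eval (X - C b) = max ‖a - b‖ r := by
  have taylor_eq : taylor a (X - C b) = X + C (a - b) := by
    rw [map_sub, taylor_X, taylor_C, C_sub]
    ring
  have coeff_zero : (X + C (a - b)).coeff 0 = a - b := by simp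
  have coeff_one : (X + C (a - b)).coeff 1 = 1 := by simp
  refine le_antisymm ?_ (max_le ?_ ?_)
  · obtain ⟨i, hi⟩ := exists_eval_diskPoint_eq a r (X - C b)
    rw [hi, taylor_eq]
    match i with
    | 0 => simp
    | 1 => simp
    | i + 2 => simp [coeff_X, r.2.le]
  · have := norm_coeff_taylor_mul_pow_le_eval_diskPoint a r (X - C b) 0
    rwa [taylor_eq, coeff_zero, pow_zero, mul_one] at this
  · have := norm_coeff_taylor_mul_pow_le_eval_diskPoint a r (X - C b) 1
    rwa [taylor_eq, coeff_one, norm_one, one_mul, pow_one] at this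

theorem eval_X_diskPoint (a : L) (r : {r : ℝ // 0 < r}) :
    (diskPoint a r).eval X = max ‖a‖ r := by
  simpa only [C_0, sub_zero] using eval_diskPoint_X_sub_C a 0 r

end DiskPoint

section Topology

theorem continuous_eval (P : L[X]) : Continuous fun x : BerkovichLine L => x.eval P :=
  (continuous_apply P).comp continuous_induced_dom

theorem range_eval : Set.range (eval : BerkovichLine L → L[X] → ℝ) =
    {F | F 0 = 0 ∧ F 1 = 1 ∧ (∀ P, F (-P) = F P) ∧ (∀ a, F (C a) = ‖a‖) ∧
      (∀ P Q, F (P + Q) ≤ F P + F Q) ∧ ∀ P Q, F (P * Q) = F P * F Q} := by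
  ext F
  constructor
  · rintro ⟨x, rfl⟩
    exact ⟨x.eval_zero, x.eval_one, x.eval_neg, x.eval_C, x.eval_add_le, x.eval_mul⟩
  · rintro ⟨map_zero, map_one, map_neg, map_C, map_add, map_mul⟩
    exact ⟨⟨{ toFun := F, map_zero' := map_zero, add_le' := map_add, neg' := map_neg,
              map_one' := map_one, map_mul' := map_mul }, map_C⟩, rfl⟩

theorem isClosedEmbedding_eval : IsClosedEmbedding (eval : BerkovichLine L → L[X] → ℝ) := by
  refine ⟨⟨⟨rfl⟩, fun x y h => ext_eval (congrFun h)⟩, ?_⟩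
  rw [range_eval]
  simp only [Set.ofPred_and, Set.ofPred_forall]
  repeat' first
    | apply IsClosed.inter
    | exact isClosed_eq (by fun_prop) (by fun_prop)
    | exact isClosed_le (by fun_prop) (by fun_prop)
    | refine isClosed_iInter fun _ => ?_

instance : T2Space (BerkovichLine L) := isClosedEmbedding_eval.isEmbedding.t2Space

theorem isClosed_setOf_eval_X_le (R : ℝ) : IsClosed {x : BerkovichLine L | x.eval X ≤ R} :=
  isClosed_le (continuous_eval X) continuous_const

theorem isCompact_setOf_eval_X_le (R : ℝ) : IsCompact {x : BerkovichLine L | x.eval X ≤ R} := by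
  let box : Set (L[X] → ℝ) := Set.univ.pi fun P =>
    Set.Icc 0 (∑ i ∈ Finset.range (P.natDegree + 1), ‖P.coeff i‖ * R ^ i)
  have isCompact_box : IsCompact box := isCompact_univ_pi fun P => isCompact_Icc
  refine (isClosedEmbedding_eval.isCompact_preimage isCompact_box).of_isClosed_subset
    (isClosed_setOf_eval_X_le R) fun x (hx : x.eval X ≤ R) P _ => ⟨x.eval_nonneg P, ?_⟩
  refine (x.eval_le_sum_norm_coeff_mul_pow P).trans (Finset.sum_le_sum fun i _ => ?_)
  have := x.eval_nonneg X
  gcongr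

instance : LocallyCompactSpace (BerkovichLine L) := by
  have : WeaklyLocallyCompactSpace (BerkovichLine L) := ⟨fun x =>
    ⟨{y | y.eval X ≤ x.eval X + 1}, isCompact_setOf_eval_X_le _, by
      filter_upwards [(continuous_eval X).tendsto x |>.eventually_le_const (lt_add_one _)]
        with y hy using hy⟩⟩
  infer_instance

end Topology

section DiskPotential

theorem continuous_diskPotential (a : L) (r : {r : ℝ // 0 < r}) :
    Continuous (diskPotential a r) :=
  ((continuous_eval _).max continuous_const).log fun _ => (lt_max_of_lt_right r.2).ne'

theorem diskPotential_zero (r : {r : ℝ // 0 < r}) :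
    diskPotential 0 r x = Real.log (max (x.eval X) r) := by
  rw [diskPotential, C_0, sub_zero]

variable [IsUltrametricDist L]

variable {x} in
theorem diskPotential_eq_log_eval_X {a : L} {r : {r : ℝ // 0 < r}} (ha : ‖a‖ < x.eval X)
    (hr : r < x.eval X) : diskPotential a r x = Real.log (x.eval X) := by
  rw [diskPotential, x.eval_X_sub_C_of_norm_lt ha, max_eq_left hr.le]

theorem diskPotential_diskPoint_comm (a b : L) (r s : {r : ℝ // 0 < r}) :
    diskPotential a r (diskPoint b s) = diskPotential b s (diskPoint a r) := by
  simp only [diskPotential, eval_diskPoint_X_sub_C, norm_sub_rev b a]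
  rw [max_right_comm]

theorem hasCompactSupport_diskPotential_sub (a b : L) (r s : {r : ℝ // 0 < r}) :
    HasCompactSupport (diskPotential a r - diskPotential b s) := by
  refine .intro (isCompact_setOf_eval_X_le (max (max ‖a‖ ‖b‖) (max r s))) fun x hx => ?_
  have hx : max (max ‖a‖ ‖b‖) (max (r : ℝ) s) < x.eval X := not_le.1 hx
  simp only [max_lt_iff] at hx
  obtain ⟨⟨ha, hb⟩, hr, hs⟩ := hx
  rw [Pi.sub_apply, diskPotential_eq_log_eval_X ha hr, diskPotential_eq_log_eval_X hb hs, sub_self]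

theorem integrable_diskPotential_sub (μ : Measure (BerkovichLine L)) [IsFiniteMeasureOnCompacts μ]
    (a b : L) (r s : {r : ℝ // 0 < r}) : Integrable (diskPotential a r - diskPotential b s) μ :=
  ((continuous_diskPotential a r).sub
    (continuous_diskPotential b s)).integrable_of_hasCompactSupport
    (hasCompactSupport_diskPotential_sub a b r s)

end DiskPotential

section PolyMap

/-- The action of a polynomial `F`, as a self-map of the line, on the Berkovich line:
`|P|_{F(x)} = |P ∘ F|_x`. -/
def polyMap (F : L[X]) (x : BerkovichLine L) : BerkovichLine L :=
  ⟨{ toFun := fun P => x.eval (P.comp F)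
     map_zero' := by simp [eval_zero]
     add_le' := fun P Q => by simpa using x.eval_add_le _ _
     neg' := fun P => by simp [eval_neg]
     map_one' := by simp [eval_one]
     map_mul' := fun P Q => by simp [eval_mul] },
   fun a => by
    change x.eval ((C a).comp F) = ‖a‖
    rw [C_comp, x.eval_C]⟩

theorem eval_polyMap (F P : L[X]) : (polyMap F x).eval P = x.eval (P.comp F) := rfl

end PolyMap

end BerkovichLine

section EscapeRate

open BerkovichLine

theorem tendsto_const_div_two_pow (B : ℝ) : Tendsto (fun n : ℕ => B / 2 ^ n) atTop (𝓝 0) :=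
  tendsto_const_nhds.div_atTop (tendsto_pow_atTop_atTop_of_one_lt one_lt_two)

variable {L : Type*} [NormedField L] (c : L)

theorem iterPoly_zero : iterPoly c 0 = X := rfl

theorem iterPoly_succ (n : ℕ) : iterPoly c (n + 1) = iterPoly c n ^ 2 + C c :=
  Function.iterate_succ_apply' _ n X

theorem iterPoly_comp (n : ℕ) : (iterPoly c n).comp (X ^ 2 + C c) = iterPoly c (n + 1) := by
  induction n with
  | zero => rw [iterPoly_succ, iterPoly_zero, X_comp]
  | succ n ih => rw [iterPoly_succ, add_comp, pow_comp, C_comp, ih, ← iterPoly_succ]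

/-- The action of `f_c = X² + c` on the Berkovich line. -/
def quadMap : BerkovichLine L → BerkovichLine L := polyMap (X ^ 2 + C c)

variable (x : BerkovichLine L)

theorem eval_X_iterate_quadMap (n : ℕ) :
    ((quadMap c)^[n] x).eval X = x.eval (iterPoly c n) := by
  induction n generalizing x with
  | zero => rfl
  | succ n ih => rw [Function.iterate_succ_apply, ih, quadMap, eval_polyMap, iterPoly_comp]

/-- The `n`-th approximation `2⁻ⁿ log⁺ |f_c^n|_x` to the escape rate. -/
def escapeApprox (n : ℕ) : ℝ := Real.posLog (x.eval (iterPoly c n)) / 2 ^ n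

theorem escapeApprox_nonneg (n : ℕ) : 0 ≤ escapeApprox c x n := by
  have := Real.posLog_nonneg (x := x.eval (iterPoly c n))
  unfold escapeApprox
  positivity

theorem escapeApprox_quadMap (n : ℕ) :
    escapeApprox c (quadMap c x) n = 2 * escapeApprox c x (n + 1) := by
  rw [escapeApprox, escapeApprox, quadMap, eval_polyMap, iterPoly_comp, pow_succ]
  field_simp

theorem continuous_escapeApprox (n : ℕ) : Continuous fun x => escapeApprox c x n := by
  simp only [escapeApprox, Real.posLog_eq_log_max_one (eval_nonneg _ _)]
  exact ((continuous_const.max (continuous_eval _)).log fun x =>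
    (lt_max_of_lt_left one_pos).ne').div_const _

theorem escapeRate_eq_limUnder : escapeRate c x = limUnder atTop (escapeApprox c x) := by
  refine congrArg (limUnder atTop) (funext fun n => ?_)
  rw [escapeApprox, Real.posLog_eq_log_max_one (x.eval_nonneg _), max_comm, one_div_mul_eq_div]

variable [IsUltrametricDist L]

theorem dist_escapeApprox_succ_le (n : ℕ) :
    dist (escapeApprox c x n) (escapeApprox c x (n + 1)) ≤ Real.posLog ‖c‖ / 2 / 2 ^ n := by
  have heq : escapeApprox c x n - escapeApprox c x (n + 1) =
      (Real.posLog (x.eval (iterPoly c n ^ 2)) -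
        Real.posLog (x.eval (iterPoly c n ^ 2 + C c))) / 2 / 2 ^ n := by
    rw [escapeApprox, escapeApprox, iterPoly_succ, x.eval_pow, Real.posLog_pow, pow_succ 2 n]
    push_cast
    field_simp
  rw [Real.dist_eq, heq, abs_div, abs_div, abs_two, abs_of_pos (by positivity : (0 : ℝ) < 2 ^ n)]
  gcongr
  simpa only [x.eval_C] using x.abs_posLog_eval_sub_posLog_eval_add_le (iterPoly c n ^ 2) (C c)

theorem tendsto_escapeApprox : Tendsto (escapeApprox c x) atTop (𝓝 (escapeRate c x)) := by
  rw [escapeRate_eq_limUnder]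
  exact (cauchySeq_of_le_geometric_two (dist_escapeApprox_succ_le c x)).tendsto_limUnder

theorem dist_escapeApprox_le (n : ℕ) :
    dist (escapeApprox c x n) (escapeRate c x) ≤ Real.posLog ‖c‖ / 2 ^ n :=
  dist_le_of_le_geometric_two_of_tendsto (dist_escapeApprox_succ_le c x) (tendsto_escapeApprox c x)
    n

theorem continuous_escapeRate : Continuous (escapeRate c) := by
  have uniform : TendstoUniformly (fun n x => escapeApprox c x n) (escapeRate c) atTop := by
    refine Metric.tendstoUniformly_iff.2 fun ε hε => ?_
    filter_upwards [(tendsto_const_div_two_pow _).eventually_lt_const hε] with n hn x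
    rw [dist_comm]
    exact (dist_escapeApprox_le c x n).trans_lt hn
  exact uniform.continuous (.of_forall (continuous_escapeApprox c))

theorem escapeRate_nonneg : 0 ≤ escapeRate c x :=
  ge_of_tendsto' (tendsto_escapeApprox c x) (escapeApprox_nonneg c x)

theorem escapeRate_quadMap : escapeRate c (quadMap c x) = 2 * escapeRate c x := by
  refine tendsto_nhds_unique (tendsto_escapeApprox c _) ?_
  simp only [funext (escapeApprox_quadMap c x)]
  exact ((tendsto_escapeApprox c x).comp (tendsto_add_atTop_nat 1)).const_mul 2

theorem escapeRate_iterate_quadMap (n : ℕ) :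
    escapeRate c ((quadMap c)^[n] x) = 2 ^ n * escapeRate c x := by
  induction n with
  | zero => rw [Function.iterate_zero_apply, pow_zero, one_mul]
  | succ n ih => rw [Function.iterate_succ_apply', escapeRate_quadMap, ih, pow_succ', mul_assoc]

theorem escapeRate_ofPoint_le (a : L) (r : {r : ℝ // 0 < r}) :
    escapeRate c (ofPoint a) ≤ escapeRate c (diskPoint a r) := by
  refine le_of_tendsto_of_tendsto' (tendsto_escapeApprox c _) (tendsto_escapeApprox c _) fun n => ?_
  exact div_le_div_of_nonneg_right
    (Real.posLog_le_posLog (eval_nonneg _ _) (norm_eval_le_eval_diskPoint a r _)) (by positivity)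

end EscapeRate

section EscapeRadius

open BerkovichLine

variable {L : Type*} [NormedField L] (c : L)

/-- Outside the disk of this radius around `0` the map `f_c` acts on absolute values as squaring,
so that `λ_c = log |X|` there. -/
def escapeRadius : ℝ := max 1 √‖c‖

theorem one_le_escapeRadius : 1 ≤ escapeRadius c := le_max_left _ _

theorem escapeRadius_pos : 0 < escapeRadius c := one_pos.trans_le (one_le_escapeRadius c)

theorem norm_le_escapeRadius_sq : ‖c‖ ≤ escapeRadius c ^ 2 :=
  Real.sqrt_le_left (escapeRadius_pos c).le |>.1 (le_max_right _ _)

variable {c} in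
theorem escapeRadius_eq_of_norm_eq_sq {s : ℝ} (hs : 1 ≤ s) (hc : ‖c‖ = s ^ 2) :
    escapeRadius c = s := by
  rw [escapeRadius, hc, Real.sqrt_sq (zero_le_one.trans hs), max_eq_right hs]

theorem log_escapeRadius : Real.log (escapeRadius c) = Real.posLog ‖c‖ / 2 := by
  rw [escapeRadius, ← Real.posLog_eq_log_max_one (Real.sqrt_nonneg _),
    eq_div_iff (by norm_num), mul_comm, ← Nat.cast_two, ← Real.posLog_pow,
    Real.sq_sqrt (norm_nonneg c)]

theorem escapeRadius_le_escapeRadius {c c' : L} (h : ‖c‖ ≤ ‖c'‖) :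
    escapeRadius c ≤ escapeRadius c' :=
  max_le_max_left 1 (Real.sqrt_le_sqrt h)

theorem log_max_escapeRadius (c' : L) :
    Real.log (max (escapeRadius c) (escapeRadius c')) = Real.posLog (max ‖c‖ ‖c'‖) / 2 := by
  rcases le_total ‖c‖ ‖c'‖ with h | h
  · rw [max_eq_right h, max_eq_right (escapeRadius_le_escapeRadius h), log_escapeRadius]
  · rw [max_eq_left h, max_eq_left (escapeRadius_le_escapeRadius h), log_escapeRadius]

variable [IsUltrametricDist L] (x : BerkovichLine L)

theorem eval_iterPoly_le_pow {t : ℝ} (hx : x.eval X ≤ t) (ht : escapeRadius c ≤ t) (n : ℕ) :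
    x.eval (iterPoly c n) ≤ t ^ 2 ^ n := by
  have ht₁ : 1 ≤ t := (one_le_escapeRadius c).trans ht
  induction n with
  | zero => rwa [pow_zero, pow_one, iterPoly_zero]
  | succ n ih =>
    rw [iterPoly_succ, pow_succ 2 n, pow_mul]
    refine (x.eval_add_le_max _ _).trans (max_le ?_ ?_)
    · rw [x.eval_pow]
      exact pow_le_pow_left₀ (x.eval_nonneg _) ih 2
    · calc x.eval (C c) = ‖c‖ := x.eval_C c
        _ ≤ escapeRadius c ^ 2 := norm_le_escapeRadius_sq c
        _ ≤ (t ^ 2 ^ n) ^ 2 := by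
          have := escapeRadius_pos c
          gcongr
          exact ht.trans (le_self_pow₀ ht₁ (by positivity))

theorem escapeRate_le_log {t : ℝ} (hx : x.eval X ≤ t) (ht : escapeRadius c ≤ t) :
    escapeRate c x ≤ Real.log t := by
  have ht₁ : 1 ≤ t := (one_le_escapeRadius c).trans ht
  refine le_of_tendsto' (tendsto_escapeApprox c x) fun n => ?_
  rw [escapeApprox, div_le_iff₀' (by positivity)]
  calc Real.posLog (x.eval (iterPoly c n)) ≤ Real.posLog (t ^ 2 ^ n) :=
        Real.posLog_le_posLog (x.eval_nonneg _) (eval_iterPoly_le_pow c x hx ht n)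
    _ = 2 ^ n * Real.log t := by
        rw [Real.posLog_pow, Real.posLog_eq_log (ht₁.trans (le_abs_self t))]
        push_cast
        rfl

variable {c x} (hx : escapeRadius c < x.eval X)
include hx

theorem eval_iterPoly_eq_pow (n : ℕ) : x.eval (iterPoly c n) = x.eval X ^ 2 ^ n := by
  have hx₁ : 1 < x.eval X := (one_le_escapeRadius c).trans_lt hx
  induction n with
  | zero => rw [pow_zero, pow_one, iterPoly_zero]
  | succ n ih =>
    have sq_eq : x.eval (iterPoly c n ^ 2) = x.eval X ^ 2 ^ (n + 1) := by
      rw [x.eval_pow, ih, ← pow_mul, ← pow_succ]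
    rw [iterPoly_succ, x.eval_add_eq_left_of_lt, sq_eq]
    calc x.eval (C c) = ‖c‖ := x.eval_C c
      _ ≤ escapeRadius c ^ 2 := norm_le_escapeRadius_sq c
      _ < x.eval X ^ 2 := pow_lt_pow_left₀ hx (escapeRadius_pos c).le two_ne_zero
      _ ≤ x.eval X ^ 2 ^ (n + 1) := pow_le_pow_right₀ hx₁.le (le_self_pow₀ one_le_two (by simp))
      _ = x.eval (iterPoly c n ^ 2) := sq_eq.symm

theorem escapeRate_eq_log : escapeRate c x = Real.log (x.eval X) := by
  have hx₁ : 1 < x.eval X := (one_le_escapeRadius c).trans_lt hx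
  refine tendsto_nhds_unique (tendsto_escapeApprox c x) (tendsto_const_nhds.congr fun n => ?_)
  rw [escapeApprox, eval_iterPoly_eq_pow hx, Real.posLog_pow,
    Real.posLog_eq_log (hx₁.le.trans (le_abs_self _)), eq_div_iff (by positivity), mul_comm]
  push_cast
  rfl

end EscapeRadius

section PointRate

open BerkovichLine

variable {L : Type*} [NormedField L] (c z : L)

/-- The escape rate `λ_c(z)` at a point `z` of the field. -/
def pointRate : ℝ := escapeRate c (ofPoint z)

variable [IsUltrametricDist L]

theorem pointRate_nonneg : 0 ≤ pointRate c z := escapeRate_nonneg c _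

variable {c z} in
theorem log_div_le_pointRate {t : ℝ} (ht : escapeRadius c < t) (n : ℕ)
    (hz : t ≤ ‖(fun w => w ^ 2 + c)^[n] z‖) : Real.log t / 2 ^ n ≤ pointRate c z := by
  have eval_X_eq : ((quadMap c)^[n] (ofPoint z)).eval X = ‖(fun w => w ^ 2 + c)^[n] z‖ := by
    rw [eval_X_iterate_quadMap, ← eval_iterPoly]
    rfl
  have ht₀ := (escapeRadius_pos c).trans ht
  rw [pointRate, div_le_iff₀' (by positivity), ← escapeRate_iterate_quadMap,
    escapeRate_eq_log (by rw [eval_X_eq]; exact ht.trans_le hz), eval_X_eq]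
  exact Real.log_le_log ht₀ hz

end PointRate

section BranchMean

variable {α : Type*}

/-- The operator that replaces a function by its mean over two branches `f` and `g` of the inverse
of a map of degree two. Its powers are the means over iterated preimages. -/
def branchMean (f g : α → α) : Module.End ℝ (α → ℝ) where
  toFun φ a := (φ (f a) + φ (g a)) / 2
  map_add' φ ψ := by ext a; simp only [Pi.add_apply]; ring
  map_smul' m φ := by ext a; simp only [Pi.smul_apply, smul_eq_mul, RingHom.id_apply]; ring

variable (f g : α → α)

theorem branchMean_apply (φ : α → ℝ) (a : α) : branchMean f g φ a = (φ (f a) + φ (g a)) / 2 := rfl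

theorem branchMean_pow_succ_apply (n : ℕ) (φ : α → ℝ) (a : α) :
    (branchMean f g ^ (n + 1)) φ a =
      ((branchMean f g ^ n) φ (f a) + (branchMean f g ^ n) φ (g a)) / 2 := by
  rw [pow_succ', Module.End.mul_apply, branchMean_apply]

theorem branchMean_pow_const (n : ℕ) (m : ℝ) : (branchMean f g ^ n) (fun _ => m) = fun _ => m := by
  induction n with
  | zero => rfl
  | succ n ih => ext a; rw [branchMean_pow_succ_apply, ih, add_self_div_two]

variable {f g} in
theorem branchMean_pow_comp {β : Type*} {f' g' : β → β} {h : β → α}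
    (hf : Function.Semiconj h f' f) (hg : Function.Semiconj h g' g) (n : ℕ) (φ : α → ℝ) :
    (branchMean f' g' ^ n) (φ ∘ h) = (branchMean f g ^ n) φ ∘ h := by
  induction n with
  | zero => rfl
  | succ n ih =>
    ext b
    rw [branchMean_pow_succ_apply, ih, Function.comp_apply, Function.comp_apply,
      Function.comp_apply, branchMean_pow_succ_apply, hf.eq, hg.eq]

section Integral

variable {X : Type*} [MeasurableSpace X] {μ : Measure X} {Φ : X → α → ℝ}
  (hΦ : ∀ a, Integrable (fun x => Φ x a) μ) (n : ℕ) (a : α)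
include hΦ

theorem integrable_branchMean_pow : Integrable (fun x => (branchMean f g ^ n) (Φ x) a) μ := by
  induction n generalizing a with
  | zero => exact hΦ a
  | succ n ih =>
    simp only [branchMean_pow_succ_apply]
    exact ((ih _).add (ih _)).div_const 2

theorem integral_branchMean_pow :
    ∫ x, (branchMean f g ^ n) (Φ x) a ∂μ = (branchMean f g ^ n) (fun a => ∫ x, Φ x a ∂μ) a := by
  induction n generalizing a with
  | zero => rfl
  | succ n ih =>
    have integrable := integrable_branchMean_pow f g hΦ n
    simp only [branchMean_pow_succ_apply]
    rw [integral_div, integral_add (integrable _) (integrable _), ih, ih]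

end Integral

variable {f g} {s : Set α} (hf : Set.MapsTo f s s) (hg : Set.MapsTo g s s) (n : ℕ) {φ ψ : α → ℝ}
  {a : α} (ha : a ∈ s) {m : ℝ}
include hf hg ha

theorem branchMean_pow_nonneg (h : ∀ a ∈ s, 0 ≤ φ a) : 0 ≤ (branchMean f g ^ n) φ a := by
  induction n generalizing a with
  | zero => exact h a ha
  | succ n ih =>
    rw [branchMean_pow_succ_apply]
    exact div_nonneg (add_nonneg (ih (hf ha)) (ih (hg ha))) zero_le_two

theorem branchMean_pow_mono (h : ∀ a ∈ s, φ a ≤ ψ a) :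
    (branchMean f g ^ n) φ a ≤ (branchMean f g ^ n) ψ a := by
  have := branchMean_pow_nonneg hf hg n ha (φ := ψ - φ) fun a ha => sub_nonneg.2 (h a ha)
  rw [map_sub] at this
  exact sub_nonneg.1 this

theorem le_branchMean_pow (h : ∀ a ∈ s, m ≤ φ a) : m ≤ (branchMean f g ^ n) φ a := by
  simpa only [branchMean_pow_const] using branchMean_pow_mono hf hg n ha (φ := fun _ => m) h

theorem branchMean_pow_le (h : ∀ a ∈ s, φ a ≤ m) : (branchMean f g ^ n) φ a ≤ m := by
  simpa only [branchMean_pow_const] using branchMean_pow_mono hf hg n ha (ψ := fun _ => m) h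

theorem abs_branchMean_pow_le (h : ∀ a ∈ s, |φ a| ≤ m) : |(branchMean f g ^ n) φ a| ≤ m :=
  abs_le.2 ⟨le_branchMean_pow hf hg n ha fun a ha => (abs_le.1 (h a ha)).1,
    branchMean_pow_le hf hg n ha fun a ha => (abs_le.1 (h a ha)).2⟩

end BranchMean

section Preimages

open BerkovichLine

variable {L : Type*} [NormedField L]

section RealInequalities

theorem div_max_sqrt_le_sqrt (t : ℝ) {r : ℝ} (hr : 0 ≤ r) : r / max t √r ≤ √r := by
  refine div_le_of_le_mul₀ (le_max_of_le_right (Real.sqrt_nonneg r)) (Real.sqrt_nonneg r) ?_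
  calc r = √r * √r := (Real.mul_self_sqrt hr).symm
    _ ≤ √r * max t √r := by gcongr; exact le_max_right _ _

theorem max_mul_eq_of_le_sqrt {A B r : ℝ} (hA : 0 ≤ A) (hr : 0 ≤ r) (hAr : A ≤ √r)
    (hBr : B ≤ √r) : max (A * B) r = max A √r * max B √r := by
  have : A * B ≤ r := by
    calc A * B ≤ A * √r := by gcongr
      _ ≤ √r * √r := by gcongr
      _ = r := Real.mul_self_sqrt hr
  rw [max_eq_right this, max_eq_right hAr, max_eq_right hBr, Real.mul_self_sqrt hr]

theorem max_mul_eq_of_isosceles {A B t r : ℝ} (hA : 0 ≤ A) (hr : 0 ≤ r)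
    (h : t ≤ A ∧ A = B ∨ B ≤ A ∧ A = t) :
    max (A * B) r = max A (r / max t √r) * max B (r / max t √r) := by
  rcases le_or_gt A √r with hAr | hAr
  · have htr : t ≤ √r := by rcases h with h | h <;> linarith
    have hBr : B ≤ √r := by rcases h with h | h <;> linarith
    rw [max_eq_right htr, Real.div_sqrt, max_mul_eq_of_le_sqrt hA hr hAr hBr]
  · have hA₀ : 0 < A := (Real.sqrt_nonneg r).trans_lt hAr
    have hrAA : r ≤ A * A :=
      (Real.mul_self_sqrt hr).symm.trans_le (mul_self_le_mul_self (Real.sqrt_nonneg r) hAr.le)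
    rcases h with ⟨_, rfl⟩ | ⟨-, rfl⟩
    · have hrA : r / max t √r ≤ A := (div_max_sqrt_le_sqrt t hr).trans hAr.le
      rw [max_eq_left hrA, max_eq_left hrAA]
    · have hrA : r / A ≤ A := (div_le_iff₀ hA₀).2 hrAA
      rw [max_eq_left hAr.le, max_eq_left hrA, mul_max_of_nonneg _ _ hA,
        mul_div_cancel₀ r hA₀.ne']

end RealInequalities

section Disks

/-- The radius of the two preimages under `z ↦ z²` of the disk with centre `w²` and radius `r`, in
residue characteristic other than `2`: it is `r / |w|` if these are disjoint, and `√r` if they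
coincide. -/
def preimageRadius (w : L) (r : {r : ℝ // 0 < r}) : {r : ℝ // 0 < r} :=
  ⟨r / max ‖w‖ √r, div_pos r.2 (lt_max_of_lt_right (Real.sqrt_pos.2 r.2))⟩

theorem preimageRadius_neg (w : L) (r : {r : ℝ // 0 < r}) :
    preimageRadius (-w) r = preimageRadius w r := by
  simp only [preimageRadius, norm_neg]

theorem preimageRadius_le_sqrt (w : L) (r : {r : ℝ // 0 < r}) : preimageRadius w r ≤ √r :=
  div_max_sqrt_le_sqrt ‖w‖ r.2.le

/-- The map which a branch `σ` of the inverse of `f_c` induces on disks, encoded as pairs of a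
centre and a radius. -/
def diskBranch (σ : L → L) (d : L × {r : ℝ // 0 < r}) : L × {r : ℝ // 0 < r} :=
  (σ d.1, preimageRadius (σ d.1) d.2)

/-- The closed unit disk, whose point on the Berkovich line is the Gauss point. -/
def unitDisk (L : Type*) [NormedField L] : L × {r : ℝ // 0 < r} := (0, ⟨1, one_pos⟩)

/-- The disks with centre and radius bounded by the escape radius of `c`. Every
preimage under `f_c` of such a disk is again one. -/
def smallDisks (c : L) : Set (L × {r : ℝ // 0 < r}) :=
  {d | ‖d.1‖ ≤ escapeRadius c ∧ d.2 ≤ escapeRadius c}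

theorem unitDisk_mem_smallDisks (c : L) : unitDisk L ∈ smallDisks c :=
  ⟨norm_zero.trans_le (escapeRadius_pos c).le, one_le_escapeRadius c⟩

theorem mapsTo_diskBranch {c : L} {σ : L → L}
    (hσ : ∀ z, ‖z‖ ≤ escapeRadius c → ‖σ z‖ ≤ escapeRadius c) :
    Set.MapsTo (diskBranch σ) (smallDisks c) (smallDisks c) := by
  rintro ⟨z, r⟩ ⟨hz, hr⟩
  refine ⟨hσ z hz, ?_⟩
  calc (preimageRadius (σ z) r : ℝ) ≤ √r := preimageRadius_le_sqrt _ _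
    _ ≤ escapeRadius c := (Real.sqrt_le_left (escapeRadius_pos c).le).2
        (hr.trans (le_self_pow₀ (one_le_escapeRadius c) two_ne_zero))

end Disks

section DiskPotential

variable [IsUltrametricDist L]

theorem eval_X_sub_C_isosceles (h2 : ‖(2 : L)‖ = 1) (w : L) (x : BerkovichLine L) :
    ‖w‖ ≤ x.eval (X - C w) ∧ x.eval (X - C w) = x.eval (X - C (-w)) ∨
      x.eval (X - C (-w)) ≤ x.eval (X - C w) ∧ x.eval (X - C w) = ‖w‖ ∨
      x.eval (X - C w) ≤ x.eval (X - C (-w)) ∧ x.eval (X - C (-w)) = ‖w‖ := by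
  have eval_two_mul : x.eval (C (2 * w)) = ‖w‖ := by rw [x.eval_C, norm_mul, h2, one_mul]
  have X_add : (X - C (-w) : L[X]) = (X - C w) + C (2 * w) := by
    rw [two_mul, C_add, C_neg]
    ring
  rcases lt_trichotomy ‖w‖ (x.eval (X - C w)) with h | h | h
  · refine .inl ⟨h.le, ?_⟩
    rw [X_add, x.eval_add_eq_left_of_lt (by rwa [eval_two_mul])]
  · refine .inr (.inl ⟨?_, h.symm⟩)
    rw [X_add]
    exact (x.eval_add_le_max _ _).trans (max_le le_rfl (eval_two_mul.trans h).le)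
  · have heq : x.eval (X - C (-w)) = ‖w‖ := by
      rw [X_add, add_comm, x.eval_add_eq_left_of_lt (by rwa [eval_two_mul]), eval_two_mul]
    exact .inr (.inr ⟨h.le.trans heq.ge, heq⟩)

theorem diskPotential_quadMap (h2 : ‖(2 : L)‖ = 1) {b c w : L} (hw : w ^ 2 = b - c)
    (r : {r : ℝ // 0 < r}) (x : BerkovichLine L) :
    diskPotential b r (quadMap c x) =
      diskPotential w (preimageRadius w r) x + diskPotential (-w) (preimageRadius (-w) r) x := by
  have comp_eq : (X - C b : L[X]).comp (X ^ 2 + C c) = (X - C w) * (X - C (-w)) := by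
    rw [eq_add_of_sub_eq hw.symm, sub_comp, X_comp, C_comp, C_neg, C_add, C_pow]
    ring
  have hs := (preimageRadius w r).2
  simp only [diskPotential]
  rw [preimageRadius_neg, ← Real.log_mul (lt_max_of_lt_right hs).ne' (lt_max_of_lt_right hs).ne',
    quadMap, eval_polyMap, comp_eq, x.eval_mul]
  congr 1
  rcases or_assoc.2 (eval_X_sub_C_isosceles h2 w x) with h | h
  · exact max_mul_eq_of_isosceles (x.eval_nonneg _) r.2.le h
  · rw [mul_comm, mul_comm (max _ _)]
    exact max_mul_eq_of_isosceles (x.eval_nonneg _) r.2.le (.inr h)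

end DiskPotential

section PreimageMean

variable [IsQuadraticallyClosed L]

/-- A square root of `u`. -/
def squareRoot (u : L) : L := (IsQuadraticallyClosed.isSquare u).choose

theorem squareRoot_sq (u : L) : squareRoot u ^ 2 = u :=
  (sq _).trans (IsQuadraticallyClosed.isSquare u).choose_spec.symm

/-- A branch `z ↦ √(z - c)` of the inverse of `f_c`; the other one is `-preimageBranch c`. -/
def preimageBranch (c z : L) : L := squareRoot (z - c)

theorem preimageBranch_sq (c z : L) : preimageBranch c z ^ 2 = z - c := squareRoot_sq _

/-- The mean of a function on `L` over the two preimages of a point under `f_c`. -/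
def preimageMean (c : L) : Module.End ℝ (L → ℝ) :=
  branchMean (preimageBranch c) (-preimageBranch c)

/-- The mean of a function of disks over the two preimages of a disk under `f_c`. -/
def preimageDiskMean (c : L) : Module.End ℝ (L × {r : ℝ // 0 < r} → ℝ) :=
  branchMean (diskBranch (preimageBranch c)) (diskBranch (-preimageBranch c))

theorem preimageDiskMean_pow_comp_fst (c : L) (n : ℕ) (φ : L → ℝ) :
    (preimageDiskMean c ^ n) (φ ∘ Prod.fst) = (preimageMean c ^ n) φ ∘ Prod.fst :=
  branchMean_pow_comp (h := Prod.fst) (fun _ => rfl) (fun _ => rfl) n φ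

variable [IsUltrametricDist L]

theorem norm_preimageBranch_le {c z : L} (hz : ‖z‖ ≤ escapeRadius c) :
    ‖preimageBranch c z‖ ≤ escapeRadius c := by
  refine le_of_sq_le_sq ?_ (escapeRadius_pos c).le
  rw [← norm_pow, preimageBranch_sq]
  exact norm_sub_le_of_norm_le (hz.trans (le_self_pow₀ (one_le_escapeRadius c) two_ne_zero))
    (norm_le_escapeRadius_sq c)

theorem mapsTo_diskBranch_preimageBranch (c : L) :
    Set.MapsTo (diskBranch (preimageBranch c)) (smallDisks c) (smallDisks c) :=
  mapsTo_diskBranch fun _ => norm_preimageBranch_le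

theorem mapsTo_diskBranch_neg_preimageBranch (c : L) :
    Set.MapsTo (diskBranch (-preimageBranch c)) (smallDisks c) (smallDisks c) :=
  mapsTo_diskBranch fun _ hz => (norm_neg _).trans_le (norm_preimageBranch_le hz)

variable (h2 : ‖(2 : L)‖ = 1) (c : L) (n : ℕ) (x : BerkovichLine L)
include h2

theorem preimageDiskMean_pow_diskPotential (d : L × {r : ℝ // 0 < r}) :
    (preimageDiskMean c ^ n) (fun d => diskPotential d.1 d.2 x) d =
      diskPotential d.1 d.2 ((quadMap c)^[n] x) / 2 ^ n := by
  unfold preimageDiskMean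
  induction n generalizing d with
  | zero => rw [pow_zero, pow_zero, div_one]; rfl
  | succ n ih =>
    rw [branchMean_pow_succ_apply, ih, ih, Function.iterate_succ_apply',
      diskPotential_quadMap h2 (preimageBranch_sq c d.1), pow_succ, ← add_div, div_div]
    rfl

theorem preimageDiskMean_pow_diskPotential_unitDisk :
    (preimageDiskMean c ^ n) (fun d => diskPotential d.1 d.2 x) (unitDisk L) =
      escapeApprox c x n := by
  rw [preimageDiskMean_pow_diskPotential h2, escapeApprox, ← eval_X_iterate_quadMap,
    Real.posLog_eq_log_max_one (eval_nonneg _ _), max_comm, unitDisk, diskPotential_zero]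

end PreimageMean

end Preimages

section BoundedSequences

theorem tendsto_limUnder_hyperfilter_of_abs_le {u : ℕ → ℝ} {B : ℝ} (h : ∀ n, |u n| ≤ B) :
    Tendsto u (hyperfilter ℕ : Filter ℕ)
      (𝓝 (limUnder (hyperfilter ℕ : Filter ℕ) u)) := by
  have mem_map : Set.Icc (-B) B ∈ (hyperfilter ℕ).map u :=
    Ultrafilter.mem_map.2 (univ_mem' fun n => abs_le.1 (h n))
  obtain ⟨l, -, hl⟩ := isCompact_Icc.ultrafilter_le_nhds' _ mem_map
  exact tendsto_nhds_limUnder ⟨l, hl⟩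

end BoundedSequences

section EquilibriumFunctional

open BerkovichLine CompactlySupported

variable {L : Type*} [NormedField L] [IsUltrametricDist L] [IsQuadraticallyClosed L] (c : L)

/-- The mean of a function over the `n`-th preimages of the Gauss point under `f_c`. -/
def gaussPreimageMean (n : ℕ) : (BerkovichLine L → ℝ) →ₗ[ℝ] ℝ :=
  LinearMap.proj (unitDisk L) ∘ₗ (preimageDiskMean c ^ n) ∘ₗ
    LinearMap.funLeft ℝ ℝ fun d => diskPoint d.1 d.2

theorem gaussPreimageMean_nonneg (n : ℕ) {φ : BerkovichLine L → ℝ} (hφ : ∀ x, 0 ≤ φ x) :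
    0 ≤ gaussPreimageMean c n φ :=
  branchMean_pow_nonneg (mapsTo_diskBranch_preimageBranch c)
    (mapsTo_diskBranch_neg_preimageBranch c) n (unitDisk_mem_smallDisks c) fun _ _ => hφ _

theorem abs_gaussPreimageMean_le (n : ℕ) {φ : BerkovichLine L → ℝ} {B : ℝ} (hφ : ∀ x, |φ x| ≤ B) :
    |gaussPreimageMean c n φ| ≤ B :=
  abs_branchMean_pow_le (mapsTo_diskBranch_preimageBranch c)
    (mapsTo_diskBranch_neg_preimageBranch c) n (unitDisk_mem_smallDisks c) fun _ _ => hφ _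

theorem gaussPreimageMean_diskPotential (h2 : ‖(2 : L)‖ = 1) (n : ℕ) (a : L)
    (r : {r : ℝ // 0 < r}) :
    gaussPreimageMean c n (diskPotential a r) = escapeApprox c (diskPoint a r) n := by
  rw [← preimageDiskMean_pow_diskPotential_unitDisk h2]
  simp only [diskPotential_diskPoint_comm _ a]
  rfl

theorem tendsto_gaussPreimageMean (φ : C_c(BerkovichLine L, ℝ)) :
    Tendsto (fun n => gaussPreimageMean c n φ) (hyperfilter ℕ : Filter ℕ)
      (𝓝 (limUnder (hyperfilter ℕ : Filter ℕ) fun n => gaussPreimageMean c n φ)) := by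
  obtain ⟨B, hB⟩ := φ.hasCompactSupport.exists_bound_of_continuous φ.continuous
  exact tendsto_limUnder_hyperfilter_of_abs_le fun n => abs_gaussPreimageMean_le c n hB

/-- The limit of the uniform measures on the `n`-th preimages of the Gauss point under `f_c`, as a
positive functional. Taking it along an ultrafilter spares the proof that it exists. -/
def equilibriumFunctional : C_c(BerkovichLine L, ℝ) →ₚ[ℝ] ℝ :=
  PositiveLinearMap.mk₀
    { toFun := fun φ => limUnder (hyperfilter ℕ : Filter ℕ) fun n => gaussPreimageMean c n φ
      map_add' := fun φ ψ => Tendsto.limUnder_eq <|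
        ((tendsto_gaussPreimageMean c φ).add (tendsto_gaussPreimageMean c ψ)).congr fun n =>
          ((gaussPreimageMean c n).map_add φ ψ).symm
      map_smul' := fun m φ => Tendsto.limUnder_eq <|
        ((tendsto_gaussPreimageMean c φ).const_mul m).congr fun n =>
          ((gaussPreimageMean c n).map_smul m φ).symm }
    fun φ hφ => ge_of_tendsto' (tendsto_gaussPreimageMean c φ) fun n =>
      gaussPreimageMean_nonneg c n hφ

theorem hasLaplacian_rieszMeasure (h2 : ‖(2 : L)‖ = 1) :
    HasLaplacian (escapeRate c) (RealRMK.rieszMeasure (equilibriumFunctional c)) := by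
  intro a b r s
  let φ : C_c(BerkovichLine L, ℝ) :=
    ⟨⟨diskPotential a r - diskPotential b s,
      (continuous_diskPotential a r).sub (continuous_diskPotential b s)⟩,
      hasCompactSupport_diskPotential_sub a b r s⟩
  have mean_eq (n : ℕ) : escapeApprox c (diskPoint a r) n - escapeApprox c (diskPoint b s) n =
      gaussPreimageMean c n φ := by
    rw [← gaussPreimageMean_diskPotential c h2, ← gaussPreimageMean_diskPotential c h2, ← map_sub]
    rfl
  refine (RealRMK.integral_rieszMeasure (equilibriumFunctional c) φ).trans ?_
  refine tendsto_nhds_unique (tendsto_gaussPreimageMean c φ) (Tendsto.congr mean_eq ?_)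
  exact ((tendsto_escapeApprox c _).sub (tendsto_escapeApprox c _)).mono_left
    Nat.hyperfilter_le_atTop

end EquilibriumFunctional

section Cutoff

theorem log_exp_one_mul {t : ℝ} (ht : 0 < t) : Real.log (Real.exp 1 * t) = 1 + Real.log t := by
  rw [Real.log_mul (Real.exp_pos 1).ne' ht.ne', Real.log_exp]

theorem le_exp_one_mul {t : ℝ} (ht : 0 ≤ t) : t ≤ Real.exp 1 * t :=
  le_mul_of_one_le_left ht (Real.one_le_exp zero_le_one)

namespace BerkovichLine

variable {L : Type*} [NormedField L] (r : {r : ℝ // 0 < r}) (x : BerkovichLine L)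

/-- A cutoff function with values in `[0, 1]`: it is `1` on the disk of centre `0` and radius `r`,
and `0` outside the disk of radius `e r`. -/
def cutoff : BerkovichLine L → ℝ :=
  diskPotential 0 ⟨Real.exp 1 * r, mul_pos (Real.exp_pos 1) r.2⟩ - diskPotential 0 r

theorem cutoff_apply : cutoff r x =
    Real.log (max (x.eval X) (Real.exp 1 * r)) - Real.log (max (x.eval X) r) := by
  rw [cutoff, Pi.sub_apply, diskPotential_zero, diskPotential_zero]

theorem cutoff_nonneg : 0 ≤ cutoff r x := by
  rw [cutoff_apply, sub_nonneg]
  exact Real.log_le_log (lt_max_of_lt_right r.2) (max_le_max_left _ (le_exp_one_mul r.2.le))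

variable {r x}

theorem cutoff_eq_one (h : x.eval X ≤ r) : cutoff r x = 1 := by
  rw [cutoff_apply, max_eq_right h, max_eq_right (h.trans (le_exp_one_mul r.2.le)),
    log_exp_one_mul r.2, add_sub_cancel_right]

theorem cutoff_lt_one (h : r < x.eval X) : cutoff r x < 1 := by
  have hx : 0 < x.eval X := r.2.trans h
  rw [cutoff_apply, max_eq_left h.le, sub_lt_iff_lt_add, ← log_exp_one_mul hx]
  refine Real.log_lt_log (lt_max_of_lt_left hx) (max_lt ?_ ?_)
  · exact lt_mul_of_one_lt_left hx (Real.one_lt_exp_iff.2 one_pos)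
  · gcongr

variable (r x) in
theorem cutoff_le_one : cutoff r x ≤ 1 :=
  (le_or_gt (x.eval X) r).elim (fun h => (cutoff_eq_one h).le) fun h => (cutoff_lt_one h).le

end BerkovichLine

end Cutoff

section CanonicalMeasure

open BerkovichLine

variable {L : Type*} [NormedField L] [IsUltrametricDist L]

theorem escapeRate_diskPoint_zero {c : L} {r : {r : ℝ // 0 < r}} (hr : escapeRadius c < r) :
    escapeRate c (diskPoint 0 r) = Real.log r := by
  have eval_X_eq : (diskPoint (0 : L) r).eval X = r := by
    rw [eval_X_diskPoint, norm_zero, max_eq_right r.2.le]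
  rw [escapeRate_eq_log (by rwa [eval_X_eq]), eval_X_eq]

theorem integrable_cutoff (μ : Measure (BerkovichLine L)) [IsFiniteMeasureOnCompacts μ]
    (r : {r : ℝ // 0 < r}) : Integrable (cutoff r) μ :=
  integrable_diskPotential_sub μ 0 0 _ r

variable {c : L} {μ : Measure (BerkovichLine L)} (hμ : HasLaplacian (escapeRate c) μ)
include hμ

theorem integral_cutoff {r : {r : ℝ // 0 < r}} (hr : escapeRadius c < r) :
    ∫ x, cutoff r x ∂μ = 1 := by
  refine (hμ 0 0 _ r).trans ?_
  rw [escapeRate_diskPoint_zero hr, escapeRate_diskPoint_zero (hr.trans_le (le_exp_one_mul r.2.le)),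
    log_exp_one_mul r.2, add_sub_cancel_right]

theorem measure_setOf_eval_X_le_le_one [IsFiniteMeasureOnCompacts μ] (t : ℝ) :
    μ {x | x.eval X ≤ t} ≤ 1 := by
  have hR : escapeRadius c < max t (escapeRadius c + 1) := lt_max_of_lt_right (lt_add_one _)
  let r : {r : ℝ // 0 < r} := ⟨_, (escapeRadius_pos c).trans hR⟩
  refine ((integrable_cutoff μ r).measure_le_integral (.of_forall (cutoff_nonneg r))
    fun x hx => (cutoff_eq_one ?_).ge).trans_eq ?_
  · exact le_max_of_le_left hx
  · rw [integral_cutoff hμ hR, ENNReal.ofReal_one]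

theorem isProbabilityMeasure_of_hasLaplacian [IsFiniteMeasureOnCompacts μ] :
    IsProbabilityMeasure μ := by
  let ball (n : ℕ) : Set (BerkovichLine L) := {x | x.eval X ≤ n}
  have monotone_ball : Monotone ball := fun m n hmn x (hx : x.eval X ≤ m) =>
    hx.trans (Nat.cast_le.2 hmn)
  have iUnion_ball : ⋃ n, ball n = Set.univ :=
    Set.eq_univ_of_forall fun x => Set.mem_iUnion.2 (exists_nat_ge (x.eval X))
  refine ⟨le_antisymm ?_ ?_⟩
  · rw [← iUnion_ball, monotone_ball.measure_iUnion]
    exact iSup_le fun n => measure_setOf_eval_X_le_le_one hμ n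
  · let r : {r : ℝ // 0 < r} := ⟨escapeRadius c + 1, add_pos (escapeRadius_pos c) one_pos⟩
    rw [← ENNReal.ofReal_one, ← integral_cutoff (r := r) hμ (lt_add_one _)]
    exact integral_le_measure (fun x _ => cutoff_le_one r x) (by simp)

omit hμ in
theorem exists_isProbabilityMeasure_and_hasLaplacian [IsQuadraticallyClosed L]
    (h2 : ‖(2 : L)‖ = 1) (c : L) : ∃ μ : Measure (BerkovichLine L),
      IsProbabilityMeasure μ ∧ HasLaplacian (escapeRate c) μ :=
  ⟨_, isProbabilityMeasure_of_hasLaplacian (hasLaplacian_rieszMeasure c h2),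
    hasLaplacian_rieszMeasure c h2⟩

omit hμ in
theorem canonicalMeasure_spec [IsQuadraticallyClosed L] (h2 : ‖(2 : L)‖ = 1) (c : L) :
    IsProbabilityMeasure (canonicalMeasure c) ∧
      HasLaplacian (escapeRate c) (canonicalMeasure c) := by
  rw [canonicalMeasure, dif_pos (exists_isProbabilityMeasure_and_hasLaplacian h2 c)]
  exact (exists_isProbabilityMeasure_and_hasLaplacian h2 c).choose_spec

end CanonicalMeasure

section Energy

open BerkovichLine

variable {L : Type*} [NormedField L] [IsUltrametricDist L] {c : L}
  {μ : Measure (BerkovichLine L)} [IsProbabilityMeasure μ] (hμ : HasLaplacian (escapeRate c) μ)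
include hμ

theorem ae_eval_X_le {r : {r : ℝ // 0 < r}} (hr : escapeRadius c < r) :
    ∀ᵐ x : BerkovichLine L ∂μ, x.eval X ≤ (r : ℝ) := by
  have integral_eq_zero : ∫ x, (1 - cutoff r x) ∂μ = 0 := by
    rw [integral_sub (integrable_const _) (integrable_cutoff μ r), integral_cutoff hμ hr,
      integral_const, probReal_univ, one_smul, sub_self]
  rw [integral_eq_zero_iff_of_nonneg (fun x => sub_nonneg.2 (cutoff_le_one r x))
    ((integrable_const _).sub (integrable_cutoff μ r))] at integral_eq_zero
  filter_upwards [integral_eq_zero] with x hx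
  by_contra! h
  exact (cutoff_lt_one h).ne' (sub_eq_zero.1 hx)

theorem diskPotential_ae_eq (a : L) (s : {r : ℝ // 0 < r}) {r : {r : ℝ // 0 < r}}
    (hr : escapeRadius c < r) :
    diskPotential a s =ᵐ[μ] fun x => (diskPotential a s x - diskPotential 0 r x) + Real.log r := by
  filter_upwards [ae_eval_X_le hμ hr] with x hx
  rw [diskPotential_zero x r, max_eq_right hx, sub_add_cancel]

theorem integrable_diskPotential (a : L) (s : {r : ℝ // 0 < r}) :
    Integrable (diskPotential a s) μ := by
  let r : {r : ℝ // 0 < r} := ⟨escapeRadius c + 1, add_pos (escapeRadius_pos c) one_pos⟩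
  exact ((integrable_diskPotential_sub μ a 0 s r).add (integrable_const _)).congr
    (diskPotential_ae_eq hμ a s (lt_add_one _)).symm

theorem integral_diskPotential (a : L) (s : {r : ℝ // 0 < r}) :
    ∫ x, diskPotential a s x ∂μ = escapeRate c (diskPoint a s) := by
  let r : {r : ℝ // 0 < r} := ⟨escapeRadius c + 1, add_pos (escapeRadius_pos c) one_pos⟩
  have hr : escapeRadius c < r := lt_add_one _
  calc ∫ x, diskPotential a s x ∂μ
      = ∫ x, (diskPotential a s x - diskPotential 0 r x + Real.log r) ∂μ :=
        integral_congr_ae (diskPotential_ae_eq hμ a s hr)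
    _ = ∫ x, (diskPotential a s x - diskPotential 0 r x) ∂μ + ∫ _, Real.log r ∂μ :=
        integral_add (integrable_diskPotential_sub μ a 0 s r) (integrable_const _)
    _ = escapeRate c (diskPoint a s) := by
        rw [hμ, escapeRate_diskPoint_zero hr, integral_const, probReal_univ, one_smul,
          sub_add_cancel]

theorem integrable_escapeRate (c' : L) : Integrable (escapeRate c') μ := by
  let r : {r : ℝ // 0 < r} := ⟨escapeRadius c + 1, add_pos (escapeRadius_pos c) one_pos⟩
  refine .of_bound (continuous_escapeRate c').aestronglyMeasurable
    (Real.log (max r (escapeRadius c'))) ?_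
  filter_upwards [ae_eval_X_le hμ (r := r) (lt_add_one _)] with x hx
  rw [Real.norm_of_nonneg (escapeRate_nonneg c' x)]
  exact escapeRate_le_log c' x (le_max_of_le_left hx) (le_max_right _ _)

variable [IsQuadraticallyClosed L] (h2 : ‖(2 : L)‖ = 1) (c' : L)
include h2

theorem integrable_escapeApprox (n : ℕ) : Integrable (fun x => escapeApprox c' x n) μ := by
  simp only [← preimageDiskMean_pow_diskPotential_unitDisk h2]
  exact integrable_branchMean_pow (Φ := fun x d => diskPotential d.1 d.2 x)
    (diskBranch (preimageBranch c')) (diskBranch (-preimageBranch c'))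
    (fun d => integrable_diskPotential hμ d.1 d.2) n (unitDisk L)

theorem integral_escapeApprox (n : ℕ) :
    ∫ x, escapeApprox c' x n ∂μ = gaussPreimageMean c' n (escapeRate c) := by
  simp only [← preimageDiskMean_pow_diskPotential_unitDisk h2]
  refine (integral_branchMean_pow (Φ := fun x d => diskPotential d.1 d.2 x)
    (diskBranch (preimageBranch c')) (diskBranch (-preimageBranch c'))
    (fun d => integrable_diskPotential hμ d.1 d.2) n (unitDisk L)).trans ?_
  simp only [integral_diskPotential hμ]
  rfl

theorem tendsto_gaussPreimageMean_escapeRate :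
    Tendsto (fun n => gaussPreimageMean c' n (escapeRate c)) atTop
      (𝓝 (∫ x, escapeRate c' x ∂μ)) := by
  refine tendsto_iff_dist_tendsto_zero.2 (squeeze_zero (fun _ => dist_nonneg) (fun n => ?_)
    (tendsto_const_div_two_pow (Real.posLog ‖c'‖)))
  rw [← integral_escapeApprox hμ h2, dist_eq_norm,
    ← integral_sub (integrable_escapeApprox hμ h2 c' n) (integrable_escapeRate hμ c')]
  calc ‖∫ x, (escapeApprox c' x n - escapeRate c' x) ∂μ‖
      ≤ Real.posLog ‖c'‖ / 2 ^ n * μ.real Set.univ :=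
        norm_integral_le_of_norm_le_const (ae_of_all _ fun x => dist_escapeApprox_le c' x n)
    _ = Real.posLog ‖c'‖ / 2 ^ n := by rw [probReal_univ, mul_one]

theorem integral_escapeRate_le :
    ∫ x, escapeRate c' x ∂μ ≤ Real.log (max (escapeRadius c') (escapeRadius c)) := by
  refine le_of_tendsto' (tendsto_gaussPreimageMean_escapeRate hμ h2 c') fun n => ?_
  refine branchMean_pow_le (mapsTo_diskBranch_preimageBranch c')
    (mapsTo_diskBranch_neg_preimageBranch c') n (unitDisk_mem_smallDisks c') fun d hd => ?_
  refine escapeRate_le_log c _ ?_ (le_max_right _ _)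
  rw [eval_X_diskPoint]
  exact le_max_of_le_left (max_le hd.1 hd.2)

theorem le_integral_escapeRate (k : ℕ) {m : ℝ}
    (h : ∀ z, ‖z‖ ≤ escapeRadius c' → m ≤ (preimageMean c' ^ k) (pointRate c) z) :
    m ≤ ∫ x, escapeRate c' x ∂μ := by
  have hf := mapsTo_diskBranch_preimageBranch c'
  have hg := mapsTo_diskBranch_neg_preimageBranch c'
  refine ge_of_tendsto ((tendsto_gaussPreimageMean_escapeRate hμ h2 c').comp
    (tendsto_add_atTop_nat k)) (.of_forall fun n => ?_)
  change m ≤ (preimageDiskMean c' ^ (n + k)) (fun d => escapeRate c (diskPoint d.1 d.2)) _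
  rw [pow_add, Module.End.mul_apply]
  refine le_branchMean_pow hf hg n (unitDisk_mem_smallDisks c') fun d hd => ?_
  calc m ≤ (preimageMean c' ^ k) (pointRate c) d.1 := h d.1 hd.1
    _ = (preimageDiskMean c' ^ k) (pointRate c ∘ Prod.fst) d := by
        rw [preimageDiskMean_pow_comp_fst, Function.comp_apply]
    _ ≤ (preimageDiskMean c' ^ k) (fun d => escapeRate c (diskPoint d.1 d.2)) d :=
        branchMean_pow_mono hf hg k hd fun d _ => escapeRate_ofPoint_le c d.1 d.2

end Energy

section LowerBounds

open BerkovichLine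

variable {L : Type*} [NormedField L]

section PreimageMean

variable [IsQuadraticallyClosed L] {c z : L} {k : ℕ} {φ : L → ℝ} {m : ℝ}

theorem neg_preimageBranch_sq (c z : L) : (-preimageBranch c z) ^ 2 = z - c := by
  rw [neg_sq, preimageBranch_sq]

theorem preimageMean_pow_succ_apply (c z : L) (k : ℕ) (φ : L → ℝ) :
    (preimageMean c ^ (k + 1)) φ z =
      ((preimageMean c ^ k) φ (preimageBranch c z) +
        (preimageMean c ^ k) φ (-preimageBranch c z)) / 2 :=
  branchMean_pow_succ_apply _ _ k φ z

theorem preimageMean_pow_nonneg (hφ : ∀ z, 0 ≤ φ z) : 0 ≤ (preimageMean c ^ k) φ z :=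
  branchMean_pow_nonneg (Set.mapsTo_univ _ _) (Set.mapsTo_univ _ _) k (Set.mem_univ z)
    fun w _ => hφ w

theorem le_preimageMean_pow_succ (h : ∀ w, w ^ 2 = z - c → m ≤ (preimageMean c ^ k) φ w) :
    m ≤ (preimageMean c ^ (k + 1)) φ z := by
  rw [preimageMean_pow_succ_apply]
  linarith [h _ (preimageBranch_sq c z), h _ (neg_preimageBranch_sq c z)]

theorem half_le_preimageMean_pow_succ (hφ : ∀ z, 0 ≤ φ z)
    (h : ∀ w, w ^ 2 = z - c → m ≤ (preimageMean c ^ k) φ w ∨ m ≤ (preimageMean c ^ k) φ (-w)) :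
    m / 2 ≤ (preimageMean c ^ (k + 1)) φ z := by
  rw [preimageMean_pow_succ_apply]
  have nonneg (w : L) : 0 ≤ (preimageMean c ^ k) φ w := preimageMean_pow_nonneg hφ
  rcases h _ (preimageBranch_sq c z) with h | h
  · linarith [nonneg (-preimageBranch c z)]
  · linarith [nonneg (preimageBranch c z)]

end PreimageMean

section Shadowing

variable {c c' p₀ p₁ p₂ p₃ : L}

/-- The difference between `f_c²(p₀)` and `p₂` for an orbit `p₀ ↦ p₁ ↦ p₂` of `f_{c'}`, as a
function of `p₁`. -/
def orbitDeviation (c c' p₁ : L) : L := (c' - c) * (c' - c - 1 - 2 * p₁)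

theorem iterate_two_eq_add_orbitDeviation (h₁ : p₁ ^ 2 = p₂ - c') (h₀ : p₀ ^ 2 = p₁ - c') :
    (fun w => w ^ 2 + c)^[2] p₀ = p₂ + orbitDeviation c c' p₁ := by
  rw [Function.iterate_succ_apply, Function.iterate_one, h₀, orbitDeviation]
  linear_combination h₁

theorem iterate_three_eq_add_orbitDeviation_mul (h₂ : p₂ ^ 2 = p₃ - c')
    (h₁ : p₁ ^ 2 = p₂ - c') (h₀ : p₀ ^ 2 = p₁ - c') :
    (fun w => w ^ 2 + c)^[3] p₀ =
      (p₃ - (c' - c)) + orbitDeviation c c' p₁ * (orbitDeviation c c' p₁ + 2 * p₂) := by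
  rw [Function.iterate_succ_apply', iterate_two_eq_add_orbitDeviation h₁ h₀]
  linear_combination h₂

theorem norm_orbitDeviation_sub_orbitDeviation_neg (h2 : ‖(2 : L)‖ = 1) (c c' p : L) :
    ‖orbitDeviation c c' p - orbitDeviation c c' (-p)‖ = ‖c' - c‖ * ‖p‖ := by
  have factor : orbitDeviation c c' p - orbitDeviation c c' (-p) =
      -(2 * 2 * ((c' - c) * p)) := by
    unfold orbitDeviation
    ring
  rw [factor, norm_neg, norm_mul, norm_mul, h2, norm_mul, one_mul, one_mul]

variable [IsUltrametricDist L] {t : ℝ}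

theorem norm_orbitDeviation (h2 : ‖(2 : L)‖ = 1) {p : L} (hp : 1 < ‖p‖) (h : ‖c' - c‖ ≤ 1) :
    ‖orbitDeviation c c' p‖ = ‖c' - c‖ * ‖p‖ := by
  have norm_neg_two_mul : ‖-(2 * p)‖ = ‖p‖ := by rw [norm_neg, norm_mul, h2, one_mul]
  have norm_sub_one_le : ‖c' - c - 1‖ ≤ 1 := norm_sub_le_of_norm_le h norm_one.le
  rw [orbitDeviation, norm_mul, sub_eq_add_neg _ (2 * p), add_comm, norm_add_eq_left_of_lt,
    norm_neg_two_mul]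
  exact norm_sub_one_le.trans_lt (norm_neg_two_mul ▸ hp)

theorem log_div_two_le_pointRate (h₀ : p₀ ^ 2 = p₁ - c') (hp : ‖p₁‖ ≤ escapeRadius c)
    (h : escapeRadius c < ‖c' - c‖) : Real.log ‖c' - c‖ / 2 ≤ pointRate c p₀ := by
  have iterate_eq : (fun w => w ^ 2 + c)^[1] p₀ = p₁ + -(c' - c) := by
    rw [Function.iterate_one, h₀]
    ring
  have bound := log_div_le_pointRate h 1 (z := p₀) <| by
    rw [iterate_eq]
    exact le_norm_add_of_lt_of_le (hp.trans_lt h) (norm_neg _).ge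
  rwa [pow_one] at bound

theorem log_div_four_le_pointRate (h₁ : p₁ ^ 2 = p₂ - c') (h₀ : p₀ ^ 2 = p₁ - c')
    (hp : ‖p₂‖ ≤ escapeRadius c) (ht : escapeRadius c < t) (h : t ≤ ‖orbitDeviation c c' p₁‖) :
    Real.log t / 4 ≤ pointRate c p₀ := by
  have bound := log_div_le_pointRate ht 2 (z := p₀) <| by
    rw [iterate_two_eq_add_orbitDeviation h₁ h₀]
    exact le_norm_add_of_lt_of_le (hp.trans_lt ht) h
  linarith

theorem log_div_eight_le_pointRate (h₂ : p₂ ^ 2 = p₃ - c') (h₁ : p₁ ^ 2 = p₂ - c')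
    (h₀ : p₀ ^ 2 = p₁ - c') (hp : ‖p₃ - (c' - c)‖ ≤ escapeRadius c) (ht : escapeRadius c < t)
    (h : t ≤ ‖orbitDeviation c c' p₁ * (orbitDeviation c c' p₁ + 2 * p₂)‖) :
    Real.log t / 8 ≤ pointRate c p₀ := by
  have bound := log_div_le_pointRate ht 3 (z := p₀) <| by
    rw [iterate_three_eq_add_orbitDeviation_mul h₂ h₁ h₀]
    exact le_norm_add_of_lt_of_le (hp.trans_lt ht) h
  linarith

theorem norm_eq_of_sq_eq_sub {s : ℝ} (hs : 1 < s) (hc : ‖c‖ = s ^ 2) {z w : L} (hz : ‖z‖ ≤ s)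
    (hw : w ^ 2 = z - c) : ‖w‖ = s := by
  refine (pow_left_inj₀ (norm_nonneg w) (zero_le_one.trans hs.le) two_ne_zero).1 ?_
  rw [← norm_pow, hw, sub_eq_add_neg, add_comm, norm_add_eq_left_of_lt, norm_neg, hc]
  rw [norm_neg, hc]
  exact hz.trans_lt (lt_self_pow₀ hs one_lt_two)

end Shadowing

variable [IsUltrametricDist L] [IsQuadraticallyClosed L] (h2 : ‖(2 : L)‖ = 1)
  {μ : Measure (BerkovichLine L)} [IsProbabilityMeasure μ] {c c' : L}
  (hμ : HasLaplacian (escapeRate c) μ)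
include h2 hμ

theorem log_norm_div_two_le_integral_of_norm_lt_left (hc : 1 < ‖c‖) (h : ‖c'‖ < ‖c‖) :
    Real.log ‖c‖ / 2 ≤ ∫ x, escapeRate c' x ∂μ := by
  refine le_integral_escapeRate hμ h2 c' 0 fun z hz => ?_
  have one_lt_sqrt : 1 < √‖c‖ := Real.lt_sqrt_of_sq_lt (by rwa [one_pow])
  have norm_eq_sq : ‖c‖ = √‖c‖ ^ 2 := (Real.sq_sqrt (norm_nonneg c)).symm
  have norm_z_lt : ‖z‖ < √‖c‖ :=
    hz.trans_lt (max_lt one_lt_sqrt (Real.sqrt_lt_sqrt (norm_nonneg c') h))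
  have norm_iterate : ‖(fun w => w ^ 2 + c)^[1] z‖ = ‖c‖ := by
    rw [Function.iterate_one, add_comm, norm_add_eq_left_of_lt]
    rw [norm_pow]
    exact (pow_lt_pow_left₀ norm_z_lt (norm_nonneg z) two_ne_zero).trans_eq norm_eq_sq.symm
  have escapeRadius_lt : escapeRadius c < ‖c‖ := by
    rw [escapeRadius_eq_of_norm_eq_sq one_lt_sqrt.le norm_eq_sq]
    exact (lt_self_pow₀ one_lt_sqrt one_lt_two).trans_eq norm_eq_sq.symm
  have bound := log_div_le_pointRate escapeRadius_lt 1 norm_iterate.ge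
  rwa [pow_one] at bound

theorem log_norm_div_two_le_integral_of_norm_lt_right (hc' : 1 < ‖c'‖) (h : ‖c‖ < ‖c'‖) :
    Real.log ‖c'‖ / 2 ≤ ∫ x, escapeRate c' x ∂μ := by
  have one_lt_sqrt : 1 < √‖c'‖ := Real.lt_sqrt_of_sq_lt (by rwa [one_pow])
  have norm_eq_sq : ‖c'‖ = √‖c'‖ ^ 2 := (Real.sq_sqrt (norm_nonneg c')).symm
  have escapeRadius_lt : escapeRadius c < √‖c'‖ :=
    max_lt one_lt_sqrt (Real.sqrt_lt_sqrt (norm_nonneg c) h)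
  refine le_integral_escapeRate hμ h2 c' 1 fun z hz => le_preimageMean_pow_succ fun w hw => ?_
  rw [escapeRadius_eq_of_norm_eq_sq one_lt_sqrt.le norm_eq_sq] at hz
  have bound := log_div_le_pointRate escapeRadius_lt 0
    (norm_eq_of_sq_eq_sub one_lt_sqrt norm_eq_sq hz hw).ge
  rwa [pow_zero, div_one, Real.log_sqrt (norm_nonneg c')] at bound

section SameEscapeRadius

variable {s : ℝ} (hs : 1 < s) (hc : ‖c‖ = s ^ 2) (hc' : ‖c'‖ = s ^ 2)
include hs hc hc'

theorem log_norm_sub_div_two_le_integral (h : s < ‖c' - c‖) :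
    Real.log ‖c' - c‖ / 2 ≤ ∫ x, escapeRate c' x ∂μ := by
  have hR := escapeRadius_eq_of_norm_eq_sq hs.le hc
  refine le_integral_escapeRate hμ h2 c' 1 fun p₁ hp₁ => le_preimageMean_pow_succ fun p₀ h₀ => ?_
  rw [escapeRadius_eq_of_norm_eq_sq hs.le hc', ← hR] at hp₁
  exact log_div_two_le_pointRate h₀ hp₁ (hR.trans_lt h)

theorem log_norm_sub_mul_div_eight_le_integral (h : 1 < ‖c' - c‖) :
    Real.log (‖c' - c‖ * s) / 8 ≤ ∫ x, escapeRate c' x ∂μ := by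
  have hR := escapeRadius_eq_of_norm_eq_sq hs.le hc
  have hR' := escapeRadius_eq_of_norm_eq_sq hs.le hc'
  have escapeRadius_lt : escapeRadius c < ‖c' - c‖ * s :=
    hR.trans_lt (lt_mul_of_one_lt_left (zero_lt_one.trans hs) h)
  refine le_integral_escapeRate hμ h2 c' 2 fun p₂ hp₂ => ?_
  rw [hR'] at hp₂
  have bound (p₁ : L) (h₁ : p₁ ^ 2 = p₂ - c') (h : ‖c' - c‖ * s ≤ ‖orbitDeviation c c' p₁‖) :
      Real.log (‖c' - c‖ * s) / 4 ≤ (preimageMean c' ^ 1) (pointRate c) p₁ :=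
    le_preimageMean_pow_succ fun _ h₀ =>
      log_div_four_le_pointRate h₁ h₀ (hp₂.trans hR.ge) escapeRadius_lt h
  have half_bound : Real.log (‖c' - c‖ * s) / 4 / 2 ≤ (preimageMean c' ^ 2) (pointRate c) p₂ := by
    refine half_le_preimageMean_pow_succ (fun z => pointRate_nonneg c z) fun p₁ h₁ => ?_
    refine (le_norm_or_le_norm_of_le_norm_sub ?_).imp (bound p₁ h₁)
      (bound (-p₁) (by rwa [neg_sq]))
    rw [norm_orbitDeviation_sub_orbitDeviation_neg h2, norm_eq_of_sq_eq_sub hs hc' hp₂ h₁]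
  linarith

theorem log_div_eight_le_integral_of_norm_sub_lt_one (h1 : 1 < ‖c' - c‖ * s)
    (h : ‖c' - c‖ < 1) : Real.log s / 8 ≤ ∫ x, escapeRate c' x ∂μ := by
  have hs₀ : 0 < s := zero_lt_one.trans hs
  have hR := escapeRadius_eq_of_norm_eq_sq hs.le hc
  have lt_mul : s < ‖c' - c‖ * s * s := lt_mul_of_one_lt_left hs₀ h1
  refine le_integral_escapeRate hμ h2 c' 3 fun p₃ hp₃ => ?_
  rw [escapeRadius_eq_of_norm_eq_sq hs.le hc'] at hp₃
  have hz : ‖p₃ - (c' - c)‖ ≤ escapeRadius c :=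
    (norm_sub_le_of_norm_le hp₃ (h.le.trans hs.le)).trans hR.ge
  refine le_preimageMean_pow_succ fun p₂ h₂ => le_preimageMean_pow_succ fun p₁ h₁ =>
    le_preimageMean_pow_succ fun p₀ h₀ => ?_
  have norm_p₂ := norm_eq_of_sq_eq_sub hs hc' hp₃ h₂
  have norm_p₁ := norm_eq_of_sq_eq_sub hs hc' norm_p₂.le h₁
  have norm_deviation : ‖orbitDeviation c c' p₁‖ = ‖c' - c‖ * s := by
    rw [norm_orbitDeviation h2 (by rwa [norm_p₁]) h.le, norm_p₁]
  have le_norm_add : s ≤ ‖orbitDeviation c c' p₁ + 2 * p₂‖ := by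
    refine le_norm_add_of_lt_of_le ?_ (by rw [norm_mul, h2, one_mul, norm_p₂])
    rw [norm_deviation]
    exact mul_lt_of_lt_one_left hs₀ h
  calc Real.log s / 8 ≤ Real.log (‖c' - c‖ * s * s) / 8 := by gcongr
    _ ≤ pointRate c p₀ := by
      refine log_div_eight_le_pointRate h₂ h₁ h₀ hz (hR.trans_lt lt_mul) ?_
      rw [norm_mul, norm_deviation]
      gcongr

theorem log_div_eight_le_integral_of_norm_sub_eq_one (h : ‖c' - c‖ = 1) :
    Real.log s / 8 ≤ ∫ x, escapeRate c' x ∂μ := by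
  have hR := escapeRadius_eq_of_norm_eq_sq hs.le hc
  refine le_integral_escapeRate hμ h2 c' 3 fun p₃ hp₃ => le_preimageMean_pow_succ fun p₂ h₂ => ?_
  rw [escapeRadius_eq_of_norm_eq_sq hs.le hc'] at hp₃
  have hz : ‖p₃ - (c' - c)‖ ≤ escapeRadius c :=
    (norm_sub_le_of_norm_le hp₃ (h.le.trans hs.le)).trans hR.ge
  have norm_p₂ := norm_eq_of_sq_eq_sub hs hc' hp₃ h₂
  have bound (p₁ : L) (h₁ : p₁ ^ 2 = p₂ - c') (h_add : s ≤ ‖orbitDeviation c c' p₁ + 2 * p₂‖) :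
      Real.log (s ^ 2) / 8 ≤ (preimageMean c' ^ 1) (pointRate c) p₁ := by
    have norm_p₁ := norm_eq_of_sq_eq_sub hs hc' norm_p₂.le h₁
    refine le_preimageMean_pow_succ fun p₀ h₀ => log_div_eight_le_pointRate h₂ h₁ h₀ hz
      (hR.trans_lt (lt_self_pow₀ hs one_lt_two)) ?_
    rw [norm_mul, norm_orbitDeviation h2 (by rwa [norm_p₁]) h.le, h, one_mul, norm_p₁, sq]
    gcongr
  have half_bound : Real.log (s ^ 2) / 8 / 2 ≤ (preimageMean c' ^ 2) (pointRate c) p₂ := by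
    refine half_le_preimageMean_pow_succ (fun z => pointRate_nonneg c z) fun p₁ h₁ => ?_
    refine (le_norm_or_le_norm_of_le_norm_sub ?_).imp (bound p₁ h₁)
      (bound (-p₁) (by rwa [neg_sq]))
    rw [add_sub_add_right_eq_sub, norm_orbitDeviation_sub_orbitDeviation_neg h2, h, one_mul,
      norm_eq_of_sq_eq_sub hs hc' norm_p₂.le h₁]
  rw [Real.log_pow] at half_bound
  push_cast at half_bound
  linarith

theorem log_div_eight_le_integral (h : 1 < ‖c' - c‖ * s) :
    Real.log s / 8 ≤ ∫ x, escapeRate c' x ∂μ := by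
  rcases lt_trichotomy ‖c' - c‖ 1 with h1 | h1 | h1
  · exact log_div_eight_le_integral_of_norm_sub_lt_one h2 hμ hs hc hc' h h1
  · exact log_div_eight_le_integral_of_norm_sub_eq_one h2 hμ hs hc hc' h1
  · have hs₀ : 0 < s := zero_lt_one.trans hs
    calc Real.log s / 8 ≤ Real.log (‖c' - c‖ * s) / 8 := by
          gcongr
          exact le_mul_of_one_le_left hs₀.le h1.le
      _ ≤ ∫ x, escapeRate c' x ∂μ := log_norm_sub_mul_div_eight_le_integral h2 hμ hs hc hc' h1

theorem log_norm_sub_div_four_le_integral_of_norm_eq (h : 1 < ‖c' - c‖) :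
    Real.log ‖c' - c‖ / 4 ≤ ∫ x, escapeRate c' x ∂μ := by
  have h₀ : 0 < ‖c' - c‖ := zero_lt_one.trans h
  rcases lt_or_ge s ‖c' - c‖ with hlt | hle
  · linarith [log_norm_sub_div_two_le_integral h2 hμ hs hc hc' hlt, Real.log_pos h]
  · have bound := log_norm_sub_mul_div_eight_le_integral h2 hμ hs hc hc' h
    rw [Real.log_mul h₀.ne' (h₀.trans_le hle).ne'] at bound
    linarith [Real.log_le_log h₀ hle]

end SameEscapeRadius

theorem log_norm_sub_div_four_le_integral (h : 1 < ‖c' - c‖) :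
    Real.log ‖c' - c‖ / 4 ≤ ∫ x, escapeRate c' x ∂μ := by
  have norm_sub_le := norm_sub_le_max_norm c' c
  have h₀ : 0 < ‖c' - c‖ := zero_lt_one.trans h
  rcases lt_trichotomy ‖c'‖ ‖c‖ with hlt | heq | hgt
  · rw [max_eq_right hlt.le] at norm_sub_le
    linarith [log_norm_div_two_le_integral_of_norm_lt_left h2 hμ (h.trans_le norm_sub_le) hlt,
      Real.log_le_log h₀ norm_sub_le, Real.log_pos h]
  · rw [heq, max_self] at norm_sub_le
    have hs : 1 < √‖c‖ := Real.lt_sqrt_of_sq_lt (by rw [one_pow]; exact h.trans_le norm_sub_le)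
    have hc : ‖c‖ = √‖c‖ ^ 2 := (Real.sq_sqrt (norm_nonneg c)).symm
    exact log_norm_sub_div_four_le_integral_of_norm_eq h2 hμ hs hc (heq.trans hc) h
  · rw [max_eq_left hgt.le] at norm_sub_le
    linarith [log_norm_div_two_le_integral_of_norm_lt_right h2 hμ (h.trans_le norm_sub_le) hgt,
      Real.log_le_log h₀ norm_sub_le, Real.log_pos h]

theorem posLog_norm_sub_div_four_le_integral :
    Real.posLog ‖c' - c‖ / 4 ≤ ∫ x, escapeRate c' x ∂μ := by
  rcases le_or_gt ‖c' - c‖ 1 with h | h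
  · rw [(Real.posLog_eq_zero_iff _).2 (by rwa [abs_norm]), zero_div]
    exact integral_nonneg fun x => escapeRate_nonneg c' x
  · rw [Real.posLog_eq_log (by rw [abs_norm]; exact h.le)]
    exact log_norm_sub_div_four_le_integral h2 hμ h

end LowerBounds

namespace NonarchPlace

variable {K : Type*} [Field K] (v : NonarchPlace K)

theorem norm_two_eq_one (h2 : ¬ v.abv 2 < 1) : ‖(2 : v.Cv)‖ = 1 := by
  refine le_antisymm ?_ ?_
  · exact_mod_cast IsUltrametricDist.norm_natCast_le_one v.Cv 2
  · rw [← map_ofNat v.toCv 2, v.norm_toCv]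
    exact not_lt.1 h2

theorem isQuadraticallyClosed_Cv (h2 : ‖(2 : v.Cv)‖ = 1) : IsQuadraticallyClosed v.Cv :=
  isQuadraticallyClosed_of_denseRange (i := UniformSpace.Completion.coeRingHom)
    UniformSpace.Completion.denseRange_coe h2

end NonarchPlace

end

theorem mainTheorem8_general {K : Type*} [Field K] (v : NonarchPlace K) (h2 : ¬ v.abv 2 < 1)
    (c₁ c₂ : K) :
    Integrable (escapeRate (v.toCv c₁)) (canonicalMeasure (v.toCv c₂)) ∧
    (1 / 4 : ℝ) * Real.posLog (v.abv (c₁ - c₂)) ≤ v.localEnergy c₁ c₂ ∧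
    v.localEnergy c₁ c₂ ≤ (1 / 2 : ℝ) * Real.posLog (max (v.abv c₁) (v.abv c₂)) ∧
    ∀ r : ℝ, v.abv c₁ = r → v.abv c₂ = r → 1 < r →
      1 / r ^ (1 / 2 : ℝ) < v.abv (c₁ - c₂) →
      (1 / 16 : ℝ) * Real.log r ≤ v.localEnergy c₁ c₂ := by
  have norm_two := v.norm_two_eq_one h2
  have := v.isQuadraticallyClosed_Cv norm_two
  obtain ⟨_, hμ⟩ := canonicalMeasure_spec norm_two (v.toCv c₂)
  simp only [← v.norm_toCv, map_sub]
  refine ⟨integrable_escapeRate hμ _, ?_, ?_, fun r h₁ h₂ hr h => ?_⟩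
  · rw [one_div_mul_eq_div]
    exact posLog_norm_sub_div_four_le_integral norm_two hμ
  · rw [one_div_mul_eq_div, ← log_max_escapeRadius]
    exact integral_escapeRate_le hμ norm_two _
  · have one_lt_sqrt : 1 < √r := Real.lt_sqrt_of_sq_lt (by rwa [one_pow])
    have sq_sqrt : r = √r ^ 2 := (Real.sq_sqrt (zero_le_one.trans hr.le)).symm
    rw [← Real.sqrt_eq_rpow, div_lt_iff₀ (zero_lt_one.trans one_lt_sqrt)] at h
    calc 1 / 16 * Real.log r = Real.log √r / 8 := by
          rw [Real.log_sqrt (zero_le_one.trans hr.le)]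
          ring
      _ ≤ v.localEnergy c₁ c₂ := log_div_eight_le_integral norm_two hμ one_lt_sqrt
          (h₂.trans sq_sqrt) (h₁.trans sq_sqrt) h

theorem mainTheorem8 {K : Type*} [Field K] [NumberField K] (v : NonarchPlace K)
    (h2 : ¬ v.abv 2 < 1) (c₁ c₂ : K) :
    Integrable (escapeRate (v.toCv c₁)) (canonicalMeasure (v.toCv c₂)) ∧
    (1 / 4 : ℝ) * Real.posLog (v.abv (c₁ - c₂)) ≤ v.localEnergy c₁ c₂ ∧
    v.localEnergy c₁ c₂ ≤ (1 / 2 : ℝ) * Real.posLog (max (v.abv c₁) (v.abv c₂)) ∧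
    ∀ r : ℝ, v.abv c₁ = r → v.abv c₂ = r → 1 < r →
      1 / r ^ (1 / 2 : ℝ) < v.abv (c₁ - c₂) →
      (1 / 16 : ℝ) * Real.log r ≤ v.localEnergy c₁ c₂ :=
  mainTheorem8_general v h2 c₁ c₂
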